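/- **Setting.** Let $V$ be a finite-dimensional real vector space, $B$ a positive definite symmetric bilinear form on $V$ (also written $B$ for its $\mathbb C$-bilinear extension to $\mathcal V=\mathbb C\otimes_{\mathbb R}V$), $Q(x)=\frac12B(x,x)$, and $L\subset V$ a lattice (the $\mathbb Z$-span of an $\mathbb R$-basis) with $B(L,L)\subseteq\mathbb Z$ and dual $L^\sharp=\{t\in V: B(t,L)\subseteq\mathbb Z\}$. Let $\mathcal W$ be a finite-dimensional complex vector space, $k\in\frac12\mathbb Z$, $\mathfrak e(x)=e^{2\pi i x}$, $q^n=\mathfrak e(n\tau)$, and $\mathbb H$ the upper half plane. For $\gamma=\begin{pmatrix}a&b\\c&d\end{pmatrix}\in \mathrm{SL}_2(\mathbb Z)$ and $\tau\in\mathbb H$ put $\gamma\tau=\frac{a\tau+b}{c\tau+d}$. For $G\le \mathrm{SL}_2(\mathbb Z)$ let $\widetilde G$ be its metaplectic double cover: the pairs $(\gamma,f)$ with $\gamma\in G$ having bottom row $(c,d)$ and $f$ one of the two continuous square roots of $\tau\mapsto c\tau+d$ on $\mathbb H$, with product $(\gamma_1,f_1)(\gamma_2,f_2)=(\gamma_1\gamma_2,\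 f_1(\gamma_2\tau)f_2(\tau))$. Let $J(G)=\widetilde G\ltimes H(L,1)$ be the group of triples $((\gamma,f),[v,w],\xi)$ with $(\gamma,f)\in\widetilde G$, $v,w\in L$, $\xi=\pm1$. Here $H(L,1)$ has the product $([v_1,w_1],\xi_1)([v_2,w_2],\xi_2)=([v_1+v_2,w_1+w_2],\xi_1\xi_2e^{\pi i(B(v_1,w_2)-B(v_2,w_1))})$, $\widetilde G$ acts on it from the right by $([v,w],\xi)\cdot(\gamma,f)=([av+cw,bv+dw],\xi)$, and the product in $J(G)$ is $(\gamma_1,h_1)(\gamma_2,h_2)=(\gamma_1\gamma_2,(h_1\cdot\gamma_2)h_2)$. For $\phi:\mathbb H\times\mathcal V\to\mathcal W$ and $g=((\gamma,f),[v,w],\xi)\in J(\mathrm{SL}_2(\mathbb Z))$ put $$(\phi|_{k,B}g)(\tau,z)=f(\tau)^{-2k}\,\xi\,\mathfrak e\!\left(-\tfrac{c}{c\tau+d}Q(z+\tau v+w)+\tau Q(v)+B(v,z)+\tfrac12B(v,w)\right)\phi\!\left(\gamma\tau,\tfrac{z+\tau v+w}{c\tau+d}\right).$$ For $h:\mathbb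 H\to\mathcal W$ and $(\gamma,f)\in\widetilde{\mathrm{SL}_2(\mathbb Z)}$ put $(h|_k(\gamma,f))(\tau)=f(\tau)^{-2k}h(\gamma\tau)$. Let $G$ have finite index in $\mathrm{SL}_2(\mathbb Z)$ and let $\rho:J(G)\to\mathrm{GL}(\mathcal W)$ be a representation with kernel of finite index; $\rho|_{\widetilde G}$ denotes its restriction along $\gamma\mapsto(\gamma,[0,0],1)$. Consider holomorphic $\phi$ with $\phi|_{k,B}g=\rho(g)\circ\phi$ for all $g\in J(G)$. For every $g\in J(\mathrm{SL}_2(\mathbb Z))$ such a $\phi$ has a Fourier expansion $\phi|_{k,B}g=\sum_{n,t}c(n,t)q^n\mathfrak e(B(t,z))$, $c(n,t)\in\mathcal W$, with $n\in\frac1N\mathbb Z$, $t\in\frac1NL^\sharp$ for some integer $N\ge1$. Call $\phi$ a *weakly holomorphic Jacobi form* if for every $g$ there is $N_0\in\mathbb Q$ such that $c(n,t)\ne0$ implies $n\ge N_0$; a *weak Jacobi form* if for every $g$, $c(n,t)\neq0$ implies $n\ge0$; a *Jacobi form* if for every $g$, $c(n,t)\ne0$ implies $n-Q(t)\ge0$.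 A *weakly holomorphic modular form* of weight $k$ for $G$ with representation $\rho'$ of $\widetilde G$ on $\mathcal W$ is a holomorphic $h:\mathbb H\to\mathcal W$ with $h|_k\gamma=\rho'(\gamma)\circ h$ for $\gamma\in\widetilde G$ such that for every $\gamma\in\widetilde{\mathrm{SL}_2(\mathbb Z)}$ one has $h|_k\gamma=\sum_{m\ge m_0}a_mq^{m/M}$ for some integers $M\ge1$ and $m_0$; it is a *modular form* (holomorphic at the cusps) if one can always take $m_0=0$, and a *cusp form* if one can always take $m_0=1$. **Theorem.** Let $(e_1,\dots,e_n)$ be an $\mathbb R$-basis of $V$ with Gram matrix $G_{\mathfrak B}=(B(e_i,e_j))$, let $\phi$ be a weakly holomorphic Jacobi form of weight $k$ for $G$, $\rho$, and let $$\phi(\tau,z_1e_1+\dots+z_ne_n)=\sum_{\mathbf j\in\mathbb Z_{\ge0}^n}h_{\mathbf j}(\tau)z_1^{j_1}\cdots z_n^{j_n}\qquad(\tau\in\mathbb H,\ z_i\in\mathbb C)$$ be its Taylor expansion. For $\mathbf p\in\mathbb Z_{\ge0}^n$ put $s(\mathbf p)=\sum_ip_i$, $\lambda=\lfloor s(\mathbf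 p)/2\rfloor$, and $$D_{k,\mathbf p}(\phi)=4^\lambda\lambda!\sum_{\Lambda}\frac{(-\pi iG_{\mathfrak B})^\Lambda}{\Lambda!}\left(\prod_{0\le r<\lambda-s(\Lambda)}(x+r)\right)\frac{d^{\,s(\Lambda)}}{d\tau^{s(\Lambda)}}h_{\mathbf p-\pi(\Lambda)},$$ where $x=k+\lambda-1$ if $s(\mathbf p)$ is even and $x=k+\lambda$ if $s(\mathbf p)$ is odd. Here $\Lambda$ runs over the $n\times n$ matrices with entries in $\mathbb Z_{\ge0}$ and entry sum $s(\Lambda)\le\lambda$; $M^\Lambda=\prod_{i,j}M_{ij}^{\Lambda_{ij}}$ (with $0^0=1$), $\Lambda!=\prod_{i,j}\Lambda_{ij}!$, $\pi(\Lambda)_i=\sum_j\Lambda_{ij}+\sum_j\Lambda_{ji}$, and $h_{\mathbf j}=0$ if $\mathbf j\notin\mathbb Z_{\ge0}^n$. (The product over $r$ is $\Gamma(x+\lambda-s(\Lambda))/\Gamma(x)$ whenever the latter is defined.) Then: 1. $D_{k,\mathbf p}(\phi)$ is a weakly holomorphic modular form of weight $k+s(\mathbf p)$ for $G$ with representation $\rho|_{\widetilde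 G}$. 2. If $\phi$ is a weak Jacobi form, then $D_{k,\mathbf p}(\phi)$ is a modular form of that weight, group and representation. 3. If $\phi$ is a Jacobi form and $\mathbf p\ne\mathbf 0$, then $D_{k,\mathbf p}(\phi)$ is a cusp form of that weight, group and representation. -/

import Mathlib

set_option linter.unusedSectionVars false

open scoped MatrixGroups TensorProduct UpperHalfPlane

noncomputable section

namespace LatticeJacobi

variable {V : Type*} [AddCommGroup V] [Module ℝ V]
variable {W : Type*} [NormedAddCommGroup W] [NormedSpace ℂ W]

/-! ### The metaplectic cover of the modular group -/

/-- The automorphy factor `c τ + d` of a matrix with bottom row `(c, d)`. -/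
def den (g : SL(2, ℤ)) (τ : ℍ) : ℂ := (g 1 0 : ℂ) * τ + (g 1 1 : ℂ)

theorem den_eq (g : SL(2, ℤ)) (τ : ℍ) : den g τ = UpperHalfPlane.denom g τ := by
  simp [den, UpperHalfPlane.denom]

theorem den_ne_zero (g : SL(2, ℤ)) (τ : ℍ) : den g τ ≠ 0 := by
  rw [den_eq]; exact UpperHalfPlane.denom_ne_zero _ _

theorem den_mul (g h : SL(2, ℤ)) (τ : ℍ) : den (g * h) τ = den g (h • τ) * den h τ := by
  have hτ := den_ne_zero h τ
  have hz : ((h • τ : ℍ) : ℂ) = ((h 0 0 : ℂ) * τ + (h 0 1 : ℂ)) / den h τ := by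
    rw [UpperHalfPlane.coe_specialLinearGroup_apply]; simp [den]
  rw [den, den, hz, add_mul, mul_assoc, div_mul_cancel₀ _ hτ]
  simp only [den, Matrix.SpecialLinearGroup.coe_mul, Matrix.mul_apply, Fin.sum_univ_two]
  push_cast
  ring

/-- The metaplectic double cover of `SL(2, ℤ)`: a matrix together with one of the two continuous
square roots of `τ ↦ c τ + d` on the upper half plane. -/
@[ext]
structure Mp where
  mat : SL(2, ℤ)
  root : ℍ → ℂ
  continuous_root : Continuous root
  root_sq : ∀ τ, root τ ^ 2 = den mat τ

namespace Mp

theorem root_ne_zero (x : Mp) (τ : ℍ) : x.root τ ≠ 0 := fun h =>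
  den_ne_zero x.mat τ (by rw [← x.root_sq, h]; simp)

theorem continuous_smul (g : SL(2, ℤ)) : Continuous fun τ : ℍ => g • τ := by
  exact continuous_const_smul (Matrix.SpecialLinearGroup.toGL
    (Matrix.SpecialLinearGroup.map (Int.castRingHom ℝ) g))

instance : One Mp := ⟨⟨1, fun _ => 1, continuous_const, fun τ => by simp [den]⟩⟩

instance : Mul Mp :=
  ⟨fun x y => ⟨x.mat * y.mat, fun τ => x.root (y.mat • τ) * y.root τ,
    (x.continuous_root.comp (continuous_smul _)).mul y.continuous_root,
    fun τ => by rw [mul_pow, x.root_sq, y.root_sq, den_mul]⟩⟩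

instance : Inv Mp :=
  ⟨fun x => ⟨x.mat⁻¹, fun τ => (x.root (x.mat⁻¹ • τ))⁻¹,
    (x.continuous_root.comp (continuous_smul _)).inv₀ fun _ => x.root_ne_zero _,
    fun τ => by
      have h := den_mul x.mat x.mat⁻¹ τ
      rw [mul_inv_cancel] at h
      rw [inv_pow, x.root_sq]
      have h1 : den 1 τ = 1 := by simp [den]
      exact inv_eq_of_mul_eq_one_right (h.symm.trans h1)⟩⟩

@[simp] theorem one_mat : (1 : Mp).mat = 1 := rfl
@[simp] theorem one_root (τ : ℍ) : (1 : Mp).root τ = 1 := rfl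
@[simp] theorem mul_mat (x y : Mp) : (x * y).mat = x.mat * y.mat := rfl
@[simp] theorem mul_root (x y : Mp) (τ : ℍ) :
    (x * y).root τ = x.root (y.mat • τ) * y.root τ := rfl
@[simp] theorem inv_mat (x : Mp) : (x⁻¹).mat = x.mat⁻¹ := rfl
@[simp] theorem inv_root (x : Mp) (τ : ℍ) : (x⁻¹).root τ = (x.root (x.mat⁻¹ • τ))⁻¹ := rfl

instance : Group Mp :=
  Group.ofLeftAxioms
    (fun x y z => by
      refine Mp.ext (mul_assoc _ _ _) (funext fun τ => ?_)
      simp [mul_smul, mul_assoc])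
    (fun x => Mp.ext (one_mul _) (funext fun τ => by simp))
    (fun x => by
      refine Mp.ext (inv_mul_cancel _) (funext fun τ => ?_)
      simp [x.root_ne_zero])

/-- The projection onto the modular group. -/
def proj : Mp →* SL(2, ℤ) where
  toFun := mat
  map_one' := rfl
  map_mul' _ _ := rfl

/-- The preimage in the double cover of a subgroup of the modular group. -/
def cover (G : Subgroup SL(2, ℤ)) : Subgroup Mp := G.comap proj

end Mp

/-! ### Lattices -/

/-- A positive definite integral lattice in the real vector space `V`: a positive definite
symmetric bilinear form on `V`, and the `ℤ`-span of an `ℝ`-basis of `V` on which the form takes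
integer values. -/
structure IntegralLattice (V : Type*) [AddCommGroup V] [Module ℝ V] where
  form : LinearMap.BilinForm ℝ V
  symm : ∀ x y, form x y = form y x
  pos : ∀ x, x ≠ 0 → 0 < form x x
  points : AddSubgroup V
  spanned : ∃ (n : ℕ) (b : Module.Basis (Fin n) ℝ V), points = AddSubgroup.closure (Set.range b)
  integral : ∀ x ∈ points, ∀ y ∈ points, ∃ m : ℤ, form x y = m

namespace IntegralLattice

/-- The quadratic form `Q(x) = B(x, x) / 2` on `V`. -/
def Q (L : IntegralLattice V) (x : V) : ℝ := L.form x x / 2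

/-- The `ℂ`-bilinear extension of the form to the complexification of `V`. -/
def formC (L : IntegralLattice V) : LinearMap.BilinForm ℂ (ℂ ⊗[ℝ] V) :=
  LinearMap.BilinForm.baseChange ℂ L.form

/-- The quadratic form on the complexification of `V`. -/
def QC (L : IntegralLattice V) (z : ℂ ⊗[ℝ] V) : ℂ := L.formC z z / 2

/-- The alternating form `A([v₁, w₁], [v₂, w₂]) = B(v₁, w₂) - B(v₂, w₁)`. -/
def alt (L : IntegralLattice V) (v₁ w₁ v₂ w₂ : V) : ℝ := L.form v₁ w₂ - L.form v₂ w₁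

/-- Membership in the dual lattice. -/
def IsDual (L : IntegralLattice V) (t : V) : Prop := ∀ x ∈ L.points, ∃ m : ℤ, L.form t x = m

end IntegralLattice

/-! ### The Jacobi group -/

/-- The semidirect product of the metaplectic group and the Heisenberg group of `V`. -/
@[ext]
structure JacobiGroup (L : IntegralLattice V) where
  mp : Mp
  v : V
  w : V
  ξ : Circle

namespace JacobiGroup

variable {L : IntegralLattice V}

/-- First component of the right action `[v, w] γ = [a v + c w, b v + d w]`. -/
def actV (g : SL(2, ℤ)) (v w : V) : V := (g 0 0 : ℤ) • v + (g 1 0 : ℤ) • w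

/-- Second component of the right action `[v, w] γ = [a v + c w, b v + d w]`. -/
def actW (g : SL(2, ℤ)) (v w : V) : V := (g 0 1 : ℤ) • v + (g 1 1 : ℤ) • w

instance : One (JacobiGroup L) := ⟨⟨1, 0, 0, 1⟩⟩

/-- `(γ₁, h₁) (γ₂, h₂) = (γ₁ γ₂, (h₁ · γ₂) h₂)`, where the product in the Heisenberg group is
`([v₁, w₁], ξ₁) ([v₂, w₂], ξ₂) = ([v₁ + v₂, w₁ + w₂], ξ₁ ξ₂ exp (π i A([v₁, w₁], [v₂, w₂])))`. -/
instance : Mul (JacobiGroup L) :=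
  ⟨fun x y => ⟨x.mp * y.mp, actV y.mp.mat x.v x.w + y.v, actW y.mp.mat x.v x.w + y.w,
    x.ξ * y.ξ * Circle.exp
      (Real.pi * L.alt (actV y.mp.mat x.v x.w) (actW y.mp.mat x.v x.w) y.v y.w)⟩⟩

instance : Inv (JacobiGroup L) :=
  ⟨fun x => ⟨x.mp⁻¹, -actV (x.mp.mat⁻¹) x.v x.w, -actW (x.mp.mat⁻¹) x.v x.w, x.ξ⁻¹⟩⟩

@[simp] theorem one_mp : (1 : JacobiGroup L).mp = 1 := rfl
@[simp] theorem one_v : (1 : JacobiGroup L).v = 0 := rfl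
@[simp] theorem one_w : (1 : JacobiGroup L).w = 0 := rfl
@[simp] theorem one_ξ : (1 : JacobiGroup L).ξ = 1 := rfl
@[simp] theorem mul_mp (x y : JacobiGroup L) : (x * y).mp = x.mp * y.mp := rfl
@[simp] theorem mul_v (x y : JacobiGroup L) : (x * y).v = actV y.mp.mat x.v x.w + y.v := rfl
@[simp] theorem mul_w (x y : JacobiGroup L) : (x * y).w = actW y.mp.mat x.v x.w + y.w := rfl
@[simp] theorem mul_ξ (x y : JacobiGroup L) : (x * y).ξ = x.ξ * y.ξ * Circle.exp
    (Real.pi * L.alt (actV y.mp.mat x.v x.w) (actW y.mp.mat x.v x.w) y.v y.w) := rfl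
@[simp] theorem inv_mp (x : JacobiGroup L) : (x⁻¹).mp = x.mp⁻¹ := rfl
@[simp] theorem inv_v (x : JacobiGroup L) : (x⁻¹).v = -actV (x.mp.mat⁻¹) x.v x.w := rfl
@[simp] theorem inv_w (x : JacobiGroup L) : (x⁻¹).w = -actW (x.mp.mat⁻¹) x.v x.w := rfl
@[simp] theorem inv_ξ (x : JacobiGroup L) : (x⁻¹).ξ = x.ξ⁻¹ := rfl

theorem actV_one (v w : V) : actV 1 v w = v := by simp [actV]

theorem actW_one (v w : V) : actW 1 v w = w := by simp [actW]

theorem actV_mul (g h : SL(2, ℤ)) (v w : V) :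
    actV (g * h) v w = actV h (actV g v w) (actW g v w) := by
  simp only [actV, actW, Matrix.SpecialLinearGroup.coe_mul, Matrix.mul_apply, Fin.sum_univ_two]
  module

theorem actW_mul (g h : SL(2, ℤ)) (v w : V) :
    actW (g * h) v w = actW h (actV g v w) (actW g v w) := by
  simp only [actV, actW, Matrix.SpecialLinearGroup.coe_mul, Matrix.mul_apply, Fin.sum_univ_two]
  module

theorem actV_add (g : SL(2, ℤ)) (v w v' w' : V) :
    actV g (v + v') (w + w') = actV g v w + actV g v' w' := by
  simp only [actV]; module

theorem actW_add (g : SL(2, ℤ)) (v w v' w' : V) :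
    actW g (v + v') (w + w') = actW g v w + actW g v' w' := by
  simp only [actW]; module

theorem alt_act (g : SL(2, ℤ)) (v₁ w₁ v₂ w₂ : V) :
    L.alt (actV g v₁ w₁) (actW g v₁ w₁) (actV g v₂ w₂) (actW g v₂ w₂) = L.alt v₁ w₁ v₂ w₂ := by
  have hdet : (g 0 0 : ℝ) * g 1 1 - g 0 1 * g 1 0 = 1 := by
    have h := g.det_coe
    rw [Matrix.det_fin_two] at h
    exact_mod_cast h
  simp only [IntegralLattice.alt, actV, actW, map_add, LinearMap.add_apply, map_zsmul,
    LinearMap.smul_apply, zsmul_eq_mul]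
  rw [L.symm v₂ v₁, L.symm w₂ v₁, L.symm v₂ w₁, L.symm w₂ w₁]
  linear_combination (L.form v₁ w₂ - L.form w₁ v₂) * hdet

theorem actV_neg (g : SL(2, ℤ)) (v w : V) : actV g (-v) (-w) = -actV g v w := by
  simp only [actV]; module

theorem actW_neg (g : SL(2, ℤ)) (v w : V) : actW g (-v) (-w) = -actW g v w := by
  simp only [actW]; module

theorem alt_self_neg (v w : V) : L.alt (-v) (-w) v w = 0 := by
  simp [IntegralLattice.alt]

instance : Group (JacobiGroup L) :=
  Group.ofLeftAxioms
    (fun x y z => by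
      refine JacobiGroup.ext (mul_assoc _ _ _) ?_ ?_ ?_
      · simp [actV_mul, actV_add, add_assoc]
      · simp [actW_mul, actW_add, add_assoc]
      · simp only [mul_ξ, mul_mp, mul_v, mul_w, Mp.mul_mat, actV_mul, actW_mul, actV_add, actW_add]
        set v₁ := actV y.mp.mat x.v x.w
        set w₁ := actW y.mp.mat x.v x.w
        rw [← alt_act (L := L) z.mp.mat v₁ w₁ y.v y.w]
        have h : ∀ a b c d e f : V,
            L.alt (a + c) (b + d) e f = L.alt a b e f + L.alt c d e f := by
          intro a b c d e f; simp [IntegralLattice.alt]; ring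
        have h' : ∀ a b c d e f : V,
            L.alt a b (c + e) (d + f) = L.alt a b c d + L.alt a b e f := by
          intro a b c d e f; simp [IntegralLattice.alt]; ring
        rw [h, h']
        simp only [mul_add, Circle.exp_add]
        simp only [mul_assoc, mul_left_comm, mul_comm])
    (fun x => JacobiGroup.ext (one_mul _) (by simp [actV]) (by simp [actW])
      (by simp [actV, actW, IntegralLattice.alt]))
    (fun x => by
      have hV : actV x.mp.mat (-actV (x.mp.mat⁻¹) x.v x.w) (-actW (x.mp.mat⁻¹) x.v x.w) =
          -x.v := by
        have h := actV_mul x.mp.mat⁻¹ x.mp.mat x.v x.w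
        rw [inv_mul_cancel, actV_one] at h
        rw [actV_neg, ← h]
      have hW : actW x.mp.mat (-actV (x.mp.mat⁻¹) x.v x.w) (-actW (x.mp.mat⁻¹) x.v x.w) =
          -x.w := by
        have h := actW_mul x.mp.mat⁻¹ x.mp.mat x.v x.w
        rw [inv_mul_cancel, actW_one] at h
        rw [actW_neg, ← h]
      refine JacobiGroup.ext (inv_mul_cancel _) ?_ ?_ ?_
      · simp [hV]
      · simp [hW]
      · simp [hV, hW, alt_self_neg])

theorem actV_mem (g : SL(2, ℤ)) {v w : V} (hv : v ∈ L.points) (hw : w ∈ L.points) :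
    actV g v w ∈ L.points :=
  add_mem (zsmul_mem hv _) (zsmul_mem hw _)

theorem actW_mem (g : SL(2, ℤ)) {v w : V} (hv : v ∈ L.points) (hw : w ∈ L.points) :
    actW g v w ∈ L.points :=
  add_mem (zsmul_mem hv _) (zsmul_mem hw _)

theorem exp_alt_sq {v₁ w₁ v₂ w₂ : V} (h₁ : v₁ ∈ L.points) (h₂ : w₁ ∈ L.points)
    (h₃ : v₂ ∈ L.points) (h₄ : w₂ ∈ L.points) :
    Circle.exp (Real.pi * L.alt v₁ w₁ v₂ w₂) ^ 2 = 1 := by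
  obtain ⟨m, hm⟩ := L.integral _ h₁ _ h₄
  obtain ⟨m', hm'⟩ := L.integral _ h₃ _ h₂
  rw [pow_two, ← Circle.exp_add, IntegralLattice.alt, hm, hm', Circle.exp_eq_one]
  exact ⟨m - m', by push_cast; ring⟩

end JacobiGroup

/-- For a subgroup `G` of the modular group, the subgroup of the Jacobi group formed by the
elements `(γ, [v, w], ξ)` with `γ` over `G`, `v` and `w` in the lattice, and `ξ = ±1`. -/
def jacobiSubgroup (L : IntegralLattice V) (G : Subgroup SL(2, ℤ)) :
    Subgroup (JacobiGroup L) where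
  carrier := {x | x.mp ∈ Mp.cover G ∧ x.v ∈ L.points ∧ x.w ∈ L.points ∧ x.ξ ^ 2 = 1}
  one_mem' := ⟨one_mem _, zero_mem _, zero_mem _, one_pow _⟩
  mul_mem' := by
    rintro x y ⟨hx, hxv, hxw, hxξ⟩ ⟨hy, hyv, hyw, hyξ⟩
    have h₁ := JacobiGroup.actV_mem y.mp.mat hxv hxw
    have h₂ := JacobiGroup.actW_mem y.mp.mat hxv hxw
    refine ⟨mul_mem hx hy, add_mem h₁ hyv, add_mem h₂ hyw, ?_⟩
    rw [JacobiGroup.mul_ξ, mul_pow, mul_pow, hxξ, hyξ, JacobiGroup.exp_alt_sq h₁ h₂ hyv hyw]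
    simp
  inv_mem' := by
    rintro x ⟨hx, hxv, hxw, hxξ⟩
    refine ⟨inv_mem hx, neg_mem (JacobiGroup.actV_mem _ hxv hxw),
      neg_mem (JacobiGroup.actW_mem _ hxv hxw), ?_⟩
    rw [JacobiGroup.inv_ξ, inv_pow, hxξ, inv_one]

/-- The embedding `γ ↦ (γ, [0, 0], 1)` of the double cover of `G` into the Jacobi group. -/
def coverToJacobi (L : IntegralLattice V) (G : Subgroup SL(2, ℤ)) :
    Mp.cover G →* jacobiSubgroup L G where
  toFun x := ⟨⟨x, 0, 0, 1⟩, x.2, zero_mem _, zero_mem _, one_pow _⟩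
  map_one' := rfl
  map_mul' x y := by
    refine Subtype.ext (JacobiGroup.ext rfl ?_ ?_ ?_) <;>
      simp [JacobiGroup.actV, JacobiGroup.actW, IntegralLattice.alt]

/-! ### Jacobi forms -/

/-- `e(x) = exp (2 π i x)`. -/
def e (x : ℂ) : ℂ := Complex.exp (2 * Real.pi * Complex.I * x)

/-- The vector `z + τ v + w` of the complexification of `V`. -/
def shift (τ : ℍ) (z : ℂ ⊗[ℝ] V) (v w : V) : ℂ ⊗[ℝ] V :=
  z + (τ : ℂ) ⊗ₜ[ℝ] v + (1 : ℂ) ⊗ₜ[ℝ] w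

/-- The automorphy factor
`ξ e(-c Q(z + τ v + w) / (c τ + d) + τ Q(v) + B(v, z) + B(v, w) / 2)`. -/
def jacobiFactor {L : IntegralLattice V} (γ : JacobiGroup L) (τ : ℍ) (z : ℂ ⊗[ℝ] V) : ℂ :=
  (γ.ξ : ℂ) * e (-((γ.mp.mat 1 0 : ℂ) / den γ.mp.mat τ) * L.QC (shift τ z γ.v γ.w)
    + τ * (L.Q γ.v : ℂ) + L.formC ((1 : ℂ) ⊗ₜ[ℝ] γ.v) z + (L.form γ.v γ.w : ℂ) / 2)

/-- The slash operator of weight `k₂ / 2` on functions on `ℍ × (ℂ ⊗ V)`. -/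
def jacobiSlash {L : IntegralLattice V} (k₂ : ℤ) (φ : ℍ → ℂ ⊗[ℝ] V → W) (γ : JacobiGroup L) :
    ℍ → ℂ ⊗[ℝ] V → W := fun τ z =>
  (γ.mp.root τ ^ (-k₂) * jacobiFactor γ τ z) •
    φ (γ.mp.mat • τ) ((den γ.mp.mat τ)⁻¹ • shift τ z γ.v γ.w)

/-- Holomorphy on `ℍ × (ℂ ⊗ V)`, in the linear coordinates given by the bases of `V`. -/
def IsHolomorphicJ (φ : ℍ → ℂ ⊗[ℝ] V → W) : Prop :=
  ∀ (n : ℕ) (b : Module.Basis (Fin n) ℝ V),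
    DifferentiableOn ℂ (fun x : ℂ × (Fin n → ℂ) =>
      φ (UpperHalfPlane.ofComplex x.1) (∑ i, x.2 i ⊗ₜ[ℝ] b i)) {x | 0 < x.1.im}

/-- Holomorphic functions that transform like a Jacobi form of weight `k₂ / 2` and index `L` under
`G` with the representation `ρ`. -/
def IsJacobiHol (k₂ : ℤ) (L : IntegralLattice V) (G : Subgroup SL(2, ℤ))
    (ρ : jacobiSubgroup L G →* (W ≃ₗ[ℂ] W)) (φ : ℍ → ℂ ⊗[ℝ] V → W) : Prop :=
  IsHolomorphicJ φ ∧
    ∀ (γ : jacobiSubgroup L G) (τ : ℍ) (z : ℂ ⊗[ℝ] V),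
      jacobiSlash k₂ φ (γ : JacobiGroup L) τ z = ρ γ (φ τ z)

/-- `f(τ, z) = ∑ c(n, t) q^n e(B(t, z))`, absolutely convergent everywhere, with `n` running over
`(1 / N) ℤ` and `t` over `(1 / N)` times the dual lattice. -/
def IsJacobiFourier (L : IntegralLattice V) (N : ℕ) (f : ℍ → ℂ ⊗[ℝ] V → W)
    (c : ℝ → V → W) : Prop :=
  (∀ n t, c n t ≠ 0 → (∃ m : ℤ, n = m / N) ∧ L.IsDual ((N : ℝ) • t)) ∧
    ∀ (τ : ℍ) (z : ℂ ⊗[ℝ] V),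
      HasSum (fun x : ℝ × V =>
        (e (x.1 * τ) * e (L.formC ((1 : ℂ) ⊗ₜ[ℝ] x.2) z)) • c x.1 x.2) (f τ z)

/-- Weakly holomorphic Jacobi forms of weight `k₂ / 2`. -/
def IsWeaklyHolomorphicJacobiForm (k₂ : ℤ) (L : IntegralLattice V) (G : Subgroup SL(2, ℤ))
    (ρ : jacobiSubgroup L G →* (W ≃ₗ[ℂ] W)) (φ : ℍ → ℂ ⊗[ℝ] V → W) : Prop :=
  IsJacobiHol k₂ L G ρ φ ∧
    ∀ γ ∈ jacobiSubgroup L ⊤, ∃ (N₀ : ℚ) (N : ℕ) (c : ℝ → V → W),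
      0 < N ∧ IsJacobiFourier L N (jacobiSlash k₂ φ γ) c ∧
        ∀ n t, c n t ≠ 0 → (N₀ : ℝ) ≤ n

/-- Weak Jacobi forms of weight `k₂ / 2`. -/
def IsWeakJacobiForm (k₂ : ℤ) (L : IntegralLattice V) (G : Subgroup SL(2, ℤ))
    (ρ : jacobiSubgroup L G →* (W ≃ₗ[ℂ] W)) (φ : ℍ → ℂ ⊗[ℝ] V → W) : Prop :=
  IsJacobiHol k₂ L G ρ φ ∧
    ∀ γ ∈ jacobiSubgroup L ⊤, ∃ (N : ℕ) (c : ℝ → V → W),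
      0 < N ∧ IsJacobiFourier L N (jacobiSlash k₂ φ γ) c ∧ ∀ n t, c n t ≠ 0 → 0 ≤ n

/-- Jacobi forms of weight `k₂ / 2`. -/
def IsJacobiForm (k₂ : ℤ) (L : IntegralLattice V) (G : Subgroup SL(2, ℤ))
    (ρ : jacobiSubgroup L G →* (W ≃ₗ[ℂ] W)) (φ : ℍ → ℂ ⊗[ℝ] V → W) : Prop :=
  IsJacobiHol k₂ L G ρ φ ∧
    ∀ γ ∈ jacobiSubgroup L ⊤, ∃ (N : ℕ) (c : ℝ → V → W),
      0 < N ∧ IsJacobiFourier L N (jacobiSlash k₂ φ γ) c ∧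
        ∀ n t, c n t ≠ 0 → 0 ≤ n - L.Q t

/-! ### Modular forms -/

/-- The slash operator of weight `k₂ / 2` on functions on `ℍ`. -/
def modularSlash (k₂ : ℤ) (f : ℍ → W) (γ : Mp) : ℍ → W := fun τ =>
  γ.root τ ^ (-k₂) • f (γ.mat • τ)

/-- Holomorphic functions on `ℍ` with the modular transformation law of weight `k₂ / 2` under `G`
with the representation `ρ`. -/
def IsModularHol (k₂ : ℤ) (G : Subgroup SL(2, ℤ)) (ρ : Mp.cover G →* (W ≃ₗ[ℂ] W))
    (f : ℍ → W) : Prop :=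
  DifferentiableOn ℂ (fun τ : ℂ => f (UpperHalfPlane.ofComplex τ)) {τ | 0 < τ.im} ∧
    ∀ (γ : Mp.cover G) (τ : ℍ), modularSlash k₂ f (γ : Mp) τ = ρ γ (f τ)

/-- `f(τ) = ∑ a(m) q^(m / M)`, absolutely convergent everywhere, for some integer `M > 0`, with
`a(m) = 0` unless `P m`. -/
def HasQExpansion (f : ℍ → W) (P : ℤ → Prop) : Prop :=
  ∃ (M : ℕ) (a : ℤ → W), 0 < M ∧ (∀ m, a m ≠ 0 → P m) ∧
    ∀ τ : ℍ, HasSum (fun m : ℤ => e (m * τ / M) • a m) (f τ)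

/-- Weakly holomorphic modular forms of weight `k₂ / 2`: meromorphic at all cusps. -/
def IsWeaklyHolomorphicModularForm (k₂ : ℤ) (G : Subgroup SL(2, ℤ))
    (ρ : Mp.cover G →* (W ≃ₗ[ℂ] W)) (f : ℍ → W) : Prop :=
  IsModularHol k₂ G ρ f ∧ ∀ γ : Mp, ∃ m₀ : ℤ, HasQExpansion (modularSlash k₂ f γ) (m₀ ≤ ·)

/-- Modular forms of weight `k₂ / 2`: holomorphic at all cusps. -/
def IsModularForm (k₂ : ℤ) (G : Subgroup SL(2, ℤ))
    (ρ : Mp.cover G →* (W ≃ₗ[ℂ] W)) (f : ℍ → W) : Prop :=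
  IsModularHol k₂ G ρ f ∧ ∀ γ : Mp, HasQExpansion (modularSlash k₂ f γ) (0 ≤ ·)

/-- Cusp forms of weight `k₂ / 2`: vanishing at all cusps. -/
def IsCuspForm (k₂ : ℤ) (G : Subgroup SL(2, ℤ))
    (ρ : Mp.cover G →* (W ≃ₗ[ℂ] W)) (f : ℍ → W) : Prop :=
  IsModularHol k₂ G ρ f ∧ ∀ γ : Mp, HasQExpansion (modularSlash k₂ f γ) (0 < ·)

/-! ### The modified Taylor coefficients -/

/-- `h` is the family of Taylor coefficients of `φ` at `z = 0` in the basis `b`: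
`φ(τ, z₁ e₁ + ⋯ + zₙ eₙ) = ∑ h_j(τ) z₁ ^ j₁ ⋯ zₙ ^ jₙ` for all `τ` and all complex `z₁, …, zₙ`. -/
def IsTaylorExpansion {n : ℕ} (b : Module.Basis (Fin n) ℝ V) (φ : ℍ → ℂ ⊗[ℝ] V → W)
    (h : (Fin n → ℕ) → ℍ → W) : Prop :=
  ∀ (τ : ℍ) (z : Fin n → ℂ),
    HasSum (fun j : Fin n → ℕ => (∏ i, z i ^ j i) • h j τ) (φ τ (∑ i, z i ⊗ₜ[ℝ] b i))

/-- The `l`-th derivative with respect to `τ` of a function on `ℍ`. -/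
def derivTau (l : ℕ) (f : ℍ → W) (τ : ℍ) : W :=
  iteratedDeriv l (fun s : ℂ => f (UpperHalfPlane.ofComplex s)) τ

/-- The sum of all entries of a matrix of nonnegative integers. -/
def matSum {n : ℕ} (Λ : Fin n → Fin n → ℕ) : ℕ := ∑ i, ∑ j, Λ i j

/-- `π_i(Λ)`: the sum of the `i`-th row of `Λ` plus the sum of the `i`-th column. -/
def matPi {n : ℕ} (Λ : Fin n → Fin n → ℕ) : Fin n → ℕ := fun i => ∑ j, Λ i j + ∑ j, Λ j i

/-- The quotient `Γ(x + m) / Γ(x)`, read as the product `x (x + 1) ⋯ (x + m - 1)`. -/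
def gammaQuot (x : ℂ) (m : ℕ) : ℂ := ∏ i ∈ Finset.range m, (x + i)

theorem gammaQuot_eq (x : ℂ) (hx : ∀ i : ℕ, x ≠ -i) (m : ℕ) :
    gammaQuot x m = Complex.Gamma (x + m) / Complex.Gamma x := by
  have h0 := Complex.Gamma_ne_zero hx
  induction m with
  | zero => simp [gammaQuot, h0]
  | succ m ih =>
    have hm : x + m ≠ 0 := fun h => hx m (eq_neg_of_add_eq_zero_left h)
    rw [gammaQuot, Finset.prod_range_succ, ← gammaQuot, ih]
    push_cast
    rw [← add_assoc, Complex.Gamma_add_one _ hm]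
    ring

open Classical in
/-- The matrices `Λ` with nonnegative integer entries of sum at most `l` and `π(Λ) ≤ p`. -/
def matIndex {n : ℕ} (l : ℕ) (p : Fin n → ℕ) : Finset (Fin n → Fin n → ℕ) :=
  {Λ ∈ Fintype.piFinset fun _ => Fintype.piFinset fun _ => Finset.range (l + 1) |
    matSum Λ ≤ l ∧ matPi Λ ≤ p}

theorem mem_matIndex {n : ℕ} (l : ℕ) (p : Fin n → ℕ) (Λ : Fin n → Fin n → ℕ) :
    Λ ∈ matIndex l p ↔ matSum Λ ≤ l ∧ matPi Λ ≤ p := by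
  simp only [matIndex, Finset.mem_filter, Fintype.mem_piFinset, Finset.mem_range,
    and_iff_right_iff_imp]
  rintro ⟨h, -⟩ i j
  have h₁ : Λ i j ≤ ∑ j, Λ i j :=
    Finset.single_le_sum (f := fun j => Λ i j) (fun _ _ => Nat.zero_le _) (Finset.mem_univ j)
  have h₂ : ∑ j, Λ i j ≤ matSum Λ :=
    Finset.single_le_sum (f := fun i => ∑ j, Λ i j) (fun _ _ => Nat.zero_le _) (Finset.mem_univ i)
  omega

/-- The sum
`4^l l! ∑_Λ (-π i G)^Λ / Λ! · Γ(x + l - s(Λ)) / Γ(x) · (d/dτ)^{s(Λ)} h_{p - π(Λ)}`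
over the matrices `Λ` with `s(Λ) ≤ l`, where `h_j` counts as zero if `j` has a negative entry. -/
def taylorCombination {n : ℕ} (Gram : Fin n → Fin n → ℝ) (x : ℂ) (l : ℕ) (p : Fin n → ℕ)
    (h : (Fin n → ℕ) → ℍ → W) (τ : ℍ) : W :=
  ((4 : ℂ) ^ l * l.factorial) • ∑ Λ ∈ matIndex l p,
    ((∏ i, ∏ j, (-Real.pi * Complex.I * Gram i j) ^ Λ i j / ((Λ i j).factorial : ℂ)) *
      gammaQuot x (l - matSum Λ)) • derivTau (matSum Λ) (h fun i => p i - matPi Λ i) τ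

/-- The combination `D_{k, p}` of derivatives of the Taylor coefficients `h` for the weight
`k = k₂ / 2`, with `l = ⌊s(p) / 2⌋`. The quotient of Gamma values is
`Γ(k + 2 l - 1 - s(Λ)) / Γ(k + l - 1)` if `s(p)` is even, and
`Γ(k + 2 l - s(Λ)) / Γ(k + l)` if `s(p)` is odd. -/
def modifiedTaylor (k₂ : ℤ) (L : IntegralLattice V) {n : ℕ} (b : Module.Basis (Fin n) ℝ V)
    (p : Fin n → ℕ) (h : (Fin n → ℕ) → ℍ → W) : ℍ → W :=
  let l : ℕ := (∑ i, p i) / 2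
  taylorCombination (fun i j => L.form (b i) (b j))
    (if Even (∑ i, p i) then (k₂ : ℂ) / 2 + l - 1 else (k₂ : ℂ) / 2 + l) l p h

end LatticeJacobi

end

open LatticeJacobi

noncomputable section

namespace LatticeJacobi

variable {V : Type*} [AddCommGroup V] [Module ℝ V]
variable {W : Type*} [NormedAddCommGroup W] [NormedSpace ℂ W]

/-! ### Rising factorials -/

/-! Restrict `φ` to a complex line `u ↦ u z`. Slashing with `(γ, [0, 0], 1)` replaces `φ(τ, u z)` by
`φ(γτ, u z / (cτ + d))` times a power of the root and `exp (A c u² / (cτ + d))`, where `A = -π i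
B(z, z)`. So the coefficients of `u ^ d` transform like modular forms up to corrections that carry
powers of `c` and involve the coefficients of degree `d - 2, d - 4, …`. Differentiating in `τ` also
creates powers of `c`. The rising factorials in `D` are chosen so that the two kinds of correction
cancel: after sorting, each unwanted coefficient is a finite difference of order `K + 1` of a
polynomial of degree at most `K` (`sum_gammaQuot_mul_choose`). The one-variable result is
`taylorComb₁_slashSeries`.

Several variables reduce to this case. Expanding `A ^ m / m!` by the multinomial theorem produces
the sum over matrices `Λ`, and comparing monomials in `z` yields `modifiedTaylor_slash`: forming `D`
commutes with slashing, for every metaplectic `γ` and not just those over `G`.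

This one identity gives everything. Over `G`, `φ|γ = ρ(γ) φ` and `D` commutes with constant linear
maps, hence the transformation law. At a cusp, `D(φ)|γ = D(φ|γ)` is read off from the Fourier
expansion of `φ|γ`, since expanding `e(B(t, z))` in `z` and differentiating in `τ` create no new
powers of `q`. For a Jacobi form, a term with `n = 0` has `Q(t) ≤ 0`, so `t = 0`; derivatives
annihilate it, and the underived term contributes only to the Taylor coefficient of index `0`. Hence
there is no constant term when `p ≠ 0`. -/

theorem gammaQuot_zero (x : ℂ) : gammaQuot x 0 = 1 := by simp [gammaQuot]

theorem gammaQuot_succ (x : ℂ) (m : ℕ) : gammaQuot x (m + 1) = gammaQuot x m * (x + m) := by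
  simp [gammaQuot, Finset.prod_range_succ]

theorem gammaQuot_succ' (x : ℂ) (m : ℕ) : gammaQuot x (m + 1) = x * gammaQuot (x + 1) m := by
  simp only [gammaQuot, Finset.prod_range_succ', Nat.cast_zero, add_zero]
  rw [mul_comm]
  congr 1
  refine Finset.prod_congr rfl fun i _ => ?_
  push_cast; ring

theorem gammaQuot_add (x : ℂ) (m l : ℕ) :
    gammaQuot x (m + l) = gammaQuot x m * gammaQuot (x + m) l := by
  simp only [gammaQuot, Finset.prod_range_add]
  congr 1
  refine Finset.prod_congr rfl fun i _ => ?_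
  push_cast; ring

/-- The rising factorial of length `m` as a polynomial. -/
def risingPoly (m : ℕ) : Polynomial ℂ := ∏ i ∈ Finset.range m, (Polynomial.X + Polynomial.C (i : ℂ))

theorem eval_risingPoly (m : ℕ) (x : ℂ) : (risingPoly m).eval x = gammaQuot x m := by
  simp [risingPoly, gammaQuot, Polynomial.eval_prod]

theorem natDegree_risingPoly_le (m : ℕ) : (risingPoly m).natDegree ≤ m := by
  refine (Polynomial.natDegree_prod_le _ _).trans ?_
  exact (Finset.sum_le_card_nsmul _ _ 1 fun i _ =>
    (Polynomial.natDegree_X_add_C _).le).trans (by simp)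

/-- `x ↦ gammaQuot x K` is a polynomial of degree at most `K`, so its difference of order `K + 1`
vanishes. -/
theorem sum_alternating_gammaQuot (K : ℕ) (Z : ℂ) :
    ∑ s ∈ Finset.range (K + 2), (-1 : ℂ) ^ s * ((K + 1).choose s : ℂ) *
      gammaQuot (Z - s) K = 0 := by
  have h := congrFun (Polynomial.fwdDiff_iter_eq_zero_of_degree_lt
    (Nat.lt_succ_of_le (natDegree_risingPoly_le K))) (Z - (K + 1 : ℕ))
  -- Forward differences step upwards from the base point `Z - (K + 1)`; reversing the sum turns
  -- this into steps down from `Z`.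
  rw [fwdDiff_iter_eq_sum_shift, ← Finset.sum_range_reflect] at h
  rw [Pi.zero_apply] at h
  rw [← h]
  refine Finset.sum_congr rfl fun s hs => ?_
  have hs' : s ≤ K + 1 := Nat.lt_succ_iff.1 (Finset.mem_range.1 hs)
  have e1 : K.succ + 1 - 1 - s = K + 1 - s := by omega
  have e2 : K.succ - (K + 1 - s) = s := by omega
  rw [e1, e2, Nat.succ_eq_add_one, Nat.choose_symm hs', eval_risingPoly]
  simp only [zsmul_eq_mul, nsmul_eq_mul, mul_one]
  push_cast [hs']
  congr 2
  ring

/-- For `1 ≤ s ≤ K` the runs `Y, …, Y + K - s` and `Y - s + 1, …, Y` share exactly `Y`, so their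
product is one unbroken run times an extra `Y`. In the extreme cases one run is empty and `Y` is an
end of the other. The unbroken run has length `K` for every `s`, so `sum_alternating_gammaQuot`
applies. -/
theorem gammaQuot_mul_gammaQuot_sub {K s : ℕ} (hs : s ≤ K + 1) (Y : ℂ) :
    gammaQuot Y (K + 1 - s) * gammaQuot (Y - s + 1) s = Y * gammaQuot (Y + 1 - s) K := by
  rcases Nat.eq_or_lt_of_le hs with rfl | hlt
  · rw [Nat.sub_self, gammaQuot_zero, one_mul, gammaQuot_succ]
    push_cast
    rw [show Y - (K + 1) + 1 = Y - K by ring, show Y + 1 - (K + 1 : ℂ) = Y - K by ring]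
    ring
  · obtain ⟨t, rfl⟩ := Nat.exists_eq_add_of_le (Nat.lt_succ_iff.1 hlt)
    rw [show s + t + 1 - s = t + 1 by omega, gammaQuot_succ', gammaQuot_add]
    rw [show Y - s + 1 = Y + 1 - s by ring,
      show Y + 1 - s + s = Y + 1 by ring]
    ring

/-- The coefficient identity behind the modularity of the modified Taylor coefficients. -/
theorem sum_gammaQuot_mul_choose {l M r : ℕ} (hM : M ≤ l) (hr : r ≤ M) (y : ℂ) :
    ∑ m ∈ Finset.range (M + 1), gammaQuot (y - l) (l - m) / (m.factorial : ℂ) *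
      (1 / ((M - m).factorial : ℂ)) * ((m.choose r : ℂ) *
        gammaQuot (y + 1 - m - M + r) (m - r) * (-1) ^ (m - r)) =
      if r = M then gammaQuot (y - l) (l - M) / (M.factorial : ℂ) else 0 := by
  obtain ⟨K, rfl⟩ := Nat.exists_eq_add_of_le hr
  have hsplit : r + K + 1 = r + (K + 1) := by ring
  rw [hsplit, Finset.sum_range_add]
  rw [Finset.sum_eq_zero, zero_add]
  swap
  · intro m hm
    simp [Nat.choose_eq_zero_of_lt (Finset.mem_range.1 hm)]
  -- With `M = r + K` and `m = r + s`, the factor `gammaQuot (y - l) (l - M)` and the factorials `r!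
  -- K!` do not depend on `s`. What remains is an alternating binomial sum of products of two runs.
  have key : ∀ s ∈ Finset.range (K + 1),
      gammaQuot (y - l) (l - (r + s)) / ((r + s).factorial : ℂ) *
      (1 / ((r + K - (r + s)).factorial : ℂ)) * (((r + s).choose r : ℂ) *
        gammaQuot (y + 1 - (r + s : ℕ) - (r + K : ℕ) + r) (r + s - r) * (-1) ^ (r + s - r)) =
      gammaQuot (y - l) (l - (r + K)) / ((r.factorial : ℂ) * K.factorial) *
      ((-1) ^ s * (K.choose s : ℂ) *
        (gammaQuot (y - (r + K : ℕ)) (K - s) * gammaQuot (y - (r + K : ℕ) - s + 1) s)) := by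
    intro s hs
    have hs' : s ≤ K := Nat.lt_succ_iff.1 (Finset.mem_range.1 hs)
    rw [show l - (r + s) = (l - (r + K)) + (K - s) by omega, gammaQuot_add,
      show r + s - r = s by omega, show r + K - (r + s) = K - s by omega]
    rw [Nat.cast_choose ℂ (Nat.le_add_right r s), Nat.cast_choose ℂ hs',
      show r + s - r = s by omega]
    rw [show y - l + (l - (r + K) : ℕ) = y - (r + K : ℕ) by push_cast [hM]; ring]
    rw [show y + 1 - (r + s : ℕ) - (r + K : ℕ) + r = y - (r + K : ℕ) - s + 1 by push_cast; ring]
    have h1 : ((r + s).factorial : ℂ) ≠ 0 := by exact_mod_cast Nat.factorial_ne_zero _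
    have h2 : ((K - s).factorial : ℂ) ≠ 0 := by exact_mod_cast Nat.factorial_ne_zero _
    have h3 : (s.factorial : ℂ) ≠ 0 := by exact_mod_cast Nat.factorial_ne_zero _
    have h4 : (r.factorial : ℂ) ≠ 0 := by exact_mod_cast Nat.factorial_ne_zero _
    have h5 : (K.factorial : ℂ) ≠ 0 := by exact_mod_cast Nat.factorial_ne_zero _
    field_simp
  rw [Finset.sum_congr rfl key, ← Finset.mul_sum]
  rcases K with _ | K
  · simp [gammaQuot_zero]
  · rw [if_neg (by omega)]
    have h := sum_alternating_gammaQuot K (y - (r + (K + 1) : ℕ) + 1)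
    refine mul_eq_zero_of_right _ ?_
    rw [← mul_zero (y - (r + (K + 1) : ℕ)), ← h, Finset.mul_sum]
    refine Finset.sum_congr rfl fun s hs => ?_
    rw [gammaQuot_mul_gammaQuot_sub (Nat.lt_succ_iff.1 (Finset.mem_range.1 hs))]
    ring

/-! ### Derivatives of functions on the upper half plane -/

/-- `f'` is the derivative of the function `f` on the upper half plane. -/
def HasTauDeriv (f f' : ℍ → W) : Prop :=
  ∀ τ : ℍ, HasDerivAt (fun s : ℂ => f (UpperHalfPlane.ofComplex s)) (f' τ) τ

/-- Holomorphy of a function on the upper half plane. -/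
def IsHolTau (f : ℍ → W) : Prop :=
  DifferentiableOn ℂ (fun τ : ℂ => f (UpperHalfPlane.ofComplex τ)) {τ | 0 < τ.im}

theorem isOpen_im_pos : IsOpen {τ : ℂ | 0 < τ.im} :=
  isOpen_lt continuous_const Complex.continuous_im

theorem im_pos_mem_nhds (τ : ℍ) : {s : ℂ | 0 < s.im} ∈ nhds (τ : ℂ) :=
  isOpen_im_pos.mem_nhds τ.im_pos

theorem coe_ofComplex_eventuallyEq (τ : ℍ) :
    ∀ᶠ s : ℂ in nhds (τ : ℂ), ((UpperHalfPlane.ofComplex s : ℍ) : ℂ) = s := by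
  filter_upwards [im_pos_mem_nhds τ] with s hs
  rw [UpperHalfPlane.ofComplex_apply_of_im_pos hs]

theorem continuousAt_ofComplex (τ : ℍ) : ContinuousAt UpperHalfPlane.ofComplex (τ : ℂ) := by
  rw [UpperHalfPlane.isOpenEmbedding_coe.isInducing.continuousAt_iff]
  exact continuousAt_id.congr (by
    filter_upwards [coe_ofComplex_eventuallyEq τ] with s hs using hs.symm)

theorem HasTauDeriv.isHolTau {f f' : ℍ → W} (hf : HasTauDeriv f f') : IsHolTau f := fun s hs =>
  (hf ⟨s, hs⟩).differentiableAt.differentiableWithinAt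

theorem derivTau_zero (f : ℍ → W) : derivTau 0 f = f := by
  funext τ; simp [derivTau]

/-- The working tool for iterated derivatives: a guessed formula for all orders is verified by
differentiating it once. -/
theorem derivTau_eq_of_hasTauDeriv {F : ℕ → ℍ → W} (hF : ∀ l, HasTauDeriv (F l) (F (l + 1)))
    (l : ℕ) : derivTau l (F 0) = F l := by
  have key : ∀ (l : ℕ) (τ : ℍ),
      iteratedDeriv l (fun s : ℂ => F 0 (UpperHalfPlane.ofComplex s)) τ = F l τ := by
    intro l
    induction l with
    | zero => intro τ; simp
    | succ l ih =>
      intro τ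
      rw [iteratedDeriv_succ, ← (hF l τ).deriv]
      refine Filter.EventuallyEq.deriv_eq ?_
      filter_upwards [im_pos_mem_nhds τ] with s hs
      have h := ih ⟨s, hs⟩
      rw [UpperHalfPlane.ofComplex_apply_of_im_pos hs]
      exact h
  funext τ
  exact key l τ

theorem differentiableOn_iteratedDeriv [CompleteSpace W] {f : ℂ → W} {U : Set ℂ} (hU : IsOpen U)
    (hf : DifferentiableOn ℂ f U) (l : ℕ) : DifferentiableOn ℂ (iteratedDeriv l f) U := by
  induction l with
  | zero => simpa using hf
  | succ l ih => rw [iteratedDeriv_succ]; exact ih.deriv hU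

theorem IsHolTau.hasTauDeriv [CompleteSpace W] {f : ℍ → W} (hf : IsHolTau f) (l : ℕ) :
    HasTauDeriv (derivTau l f) (derivTau (l + 1) f) := by
  intro τ
  have h := (differentiableOn_iteratedDeriv isOpen_im_pos hf l).differentiableAt
    (im_pos_mem_nhds τ)
  have h' := h.hasDerivAt
  rw [← iteratedDeriv_succ] at h'
  refine h'.congr_of_eventuallyEq ?_
  filter_upwards [coe_ofComplex_eventuallyEq τ] with s hs
  rw [derivTau, hs]

theorem IsHolTau.derivTau [CompleteSpace W] {f : ℍ → W} (hf : IsHolTau f) (l : ℕ) :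
    IsHolTau (derivTau l f) := (hf.hasTauDeriv l).isHolTau

theorem HasTauDeriv.sum {ι : Type*} {s : Finset ι} {f f' : ι → ℍ → W}
    (h : ∀ i ∈ s, HasTauDeriv (f i) (f' i)) :
    HasTauDeriv (fun τ => ∑ i ∈ s, f i τ) (fun τ => ∑ i ∈ s, f' i τ) := fun τ =>
  HasDerivAt.fun_sum fun i hi => h i hi τ

theorem HasTauDeriv.const_smul {f f' : ℍ → W} (h : HasTauDeriv f f') (c : ℂ) :
    HasTauDeriv (fun τ => c • f τ) (fun τ => c • f' τ) := fun τ => (h τ).fun_const_smul c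

theorem HasTauDeriv.clm_comp {W' : Type*} [NormedAddCommGroup W'] [NormedSpace ℂ W']
    {f f' : ℍ → W} (h : HasTauDeriv f f') (T : W →L[ℂ] W') :
    HasTauDeriv (fun τ => T (f τ)) (fun τ => T (f' τ)) := fun τ =>
  T.hasFDerivAt.comp_hasDerivAt _ (h τ)

theorem derivTau_sum_const_smul [CompleteSpace W] {ι : Type*} (s : Finset ι) (c : ι → ℂ)
    {f : ι → ℍ → W} (h : ∀ i ∈ s, IsHolTau (f i)) (l : ℕ) :
    derivTau l (fun τ => ∑ i ∈ s, c i • f i τ) = fun τ => ∑ i ∈ s, c i • derivTau l (f i) τ := by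
  have := derivTau_eq_of_hasTauDeriv (F := fun l τ => ∑ i ∈ s, c i • derivTau l (f i) τ)
    (fun l => HasTauDeriv.sum fun i hi => ((h i hi).hasTauDeriv l).const_smul (c i)) l
  simpa only [derivTau_zero] using this

theorem derivTau_clm_comp [CompleteSpace W] {W' : Type*} [NormedAddCommGroup W'] [NormedSpace ℂ W']
    (T : W →L[ℂ] W') {f : ℍ → W} (h : IsHolTau f) (l : ℕ) :
    derivTau l (fun τ => T (f τ)) = fun τ => T (derivTau l f τ) := by
  have := derivTau_eq_of_hasTauDeriv (F := fun l τ => T (derivTau l f τ))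
    (fun l => (h.hasTauDeriv l).clm_comp T) l
  simpa only [derivTau_zero] using this

theorem IsHolTau.sum_const_smul {ι : Type*} (s : Finset ι) (c : ι → ℂ)
    {f : ι → ℍ → W} (h : ∀ i ∈ s, IsHolTau (f i)) : IsHolTau fun τ => ∑ i ∈ s, c i • f i τ :=
  DifferentiableOn.fun_sum fun i hi => (h i hi).const_smul (c i)

/-! ### The action of the metaplectic group -/

namespace Mp

/-- Continuity of the root suffices: since its square is `cτ + d`, the difference quotient equals `c
/ (f(s) + f(τ))`, whose limit exists because the root has no zeros. -/
theorem hasTauDeriv_root (γ : Mp) :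
    HasTauDeriv γ.root fun τ => (γ.mat 1 0 : ℂ) / (2 * γ.root τ) := by
  intro τ
  rw [hasDerivAt_iff_tendsto_slope]
  have h0 := γ.root_ne_zero τ
  have hcont : ContinuousAt (fun s : ℂ => γ.root (UpperHalfPlane.ofComplex s)) τ :=
    ContinuousAt.comp (g := γ.root) γ.continuous_root.continuousAt (continuousAt_ofComplex τ)
  have hadd : Filter.Tendsto (fun s : ℂ => γ.root (UpperHalfPlane.ofComplex s) + γ.root τ)
      (nhds (τ : ℂ)) (nhds (2 * γ.root τ)) := by
    have := hcont.tendsto.add_const (γ.root τ)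
    rwa [UpperHalfPlane.ofComplex_apply, ← two_mul] at this
  have h2 : 2 * γ.root τ ≠ 0 := mul_ne_zero two_ne_zero h0
  refine ((tendsto_const_nhds.div hadd h2).mono_left nhdsWithin_le_nhds).congr' ?_
  filter_upwards [nhdsWithin_le_nhds (coe_ofComplex_eventuallyEq τ),
    nhdsWithin_le_nhds (hadd.eventually_ne h2), self_mem_nhdsWithin] with s hs hs2 hne
  have hne' : s - τ ≠ 0 := sub_ne_zero.2 hne
  rw [slope_def_field, UpperHalfPlane.ofComplex_apply]
  change (γ.mat 1 0 : ℂ) / (γ.root (UpperHalfPlane.ofComplex s) + γ.root τ) = _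
  rw [div_eq_div_iff hs2 hne']
  have e1 := γ.root_sq (UpperHalfPlane.ofComplex s)
  have e2 := γ.root_sq τ
  rw [den, hs] at e1
  rw [den] at e2
  linear_combination e2 - e1

theorem hasTauDeriv_smul (γ : Mp) :
    HasTauDeriv (fun τ => ((γ.mat • τ : ℍ) : ℂ)) fun τ => γ.root τ ^ (-4 : ℤ) := by
  have hz : ∀ τ : ℍ, ((γ.mat • τ : ℍ) : ℂ) =
      ((γ.mat 0 0 : ℂ) * τ + (γ.mat 0 1 : ℂ)) / ((γ.mat 1 0 : ℂ) * τ + (γ.mat 1 1 : ℂ)) := by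
    intro τ
    rw [UpperHalfPlane.coe_specialLinearGroup_apply]; simp
  intro τ
  have hd : ((γ.mat 1 0 : ℂ) * τ + (γ.mat 1 1 : ℂ)) ≠ 0 := den_ne_zero γ.mat τ
  have hdet : (γ.mat 0 0 : ℂ) * γ.mat 1 1 - γ.mat 0 1 * γ.mat 1 0 = 1 := by
    have h := γ.mat.det_coe
    rw [Matrix.det_fin_two] at h
    exact_mod_cast h
  have h1 := (((hasDerivAt_id (τ : ℂ)).const_mul (γ.mat 0 0 : ℂ)).add_const (γ.mat 0 1 : ℂ)).div
    (((hasDerivAt_id (τ : ℂ)).const_mul (γ.mat 1 0 : ℂ)).add_const (γ.mat 1 1 : ℂ)) hd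
  have h4 : γ.root τ ^ (-4 : ℤ) = (((γ.mat 1 0 : ℂ) * τ + (γ.mat 1 1 : ℂ)) ^ 2)⁻¹ := by
    rw [← den, ← γ.root_sq, zpow_neg, ← pow_mul]; norm_cast
  refine (h1.congr_of_eventuallyEq ?_).congr_deriv ?_
  · filter_upwards [coe_ofComplex_eventuallyEq τ] with s hs
    rw [hz, hs]
    rfl
  · change _ = γ.root τ ^ (-4 : ℤ)
    rw [h4, div_eq_mul_inv]
    simp only [id]
    linear_combination (((γ.mat 1 0 : ℂ) * τ + (γ.mat 1 1 : ℂ)) ^ 2)⁻¹ * hdet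

theorem hasTauDeriv_comp_smul (γ : Mp) {g g' : ℍ → W} (hg : HasTauDeriv g g') :
    HasTauDeriv (fun τ => g (γ.mat • τ)) fun τ => γ.root τ ^ (-4 : ℤ) • g' (γ.mat • τ) := by
  intro τ
  have h1 := γ.hasTauDeriv_smul τ
  have h2 := hg (γ.mat • τ)
  have h3 : HasDerivAt (fun s : ℂ => g (UpperHalfPlane.ofComplex s)) (g' (γ.mat • τ))
      ((fun s : ℂ => ((γ.mat • (UpperHalfPlane.ofComplex s) : ℍ) : ℂ)) τ) := by
    simpa using h2
  have h4 := h3.scomp (τ : ℂ) h1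
  refine h4.congr_of_eventuallyEq (Filter.Eventually.of_forall fun s => ?_)
  simp

theorem hasTauDeriv_zpow_smul_comp (γ : Mp) (N : ℤ) {g g' : ℍ → W} (hg : HasTauDeriv g g') :
    HasTauDeriv (fun τ => γ.root τ ^ N • g (γ.mat • τ)) fun τ =>
      ((N / 2 : ℂ) * (γ.mat 1 0 : ℂ) * γ.root τ ^ (N - 2)) • g (γ.mat • τ) +
        γ.root τ ^ (N - 4) • g' (γ.mat • τ) := by
  intro τ
  have h0 := γ.root_ne_zero τ
  have h1 := γ.hasTauDeriv_root τ
  have h2 : HasDerivAt (fun s : ℂ => γ.root (UpperHalfPlane.ofComplex s) ^ N)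
      ((N / 2 : ℂ) * (γ.mat 1 0 : ℂ) * γ.root τ ^ (N - 2)) τ := by
    have h3 := (hasDerivAt_zpow N (γ.root (UpperHalfPlane.ofComplex (τ : ℂ)))
      (Or.inl (by simpa using h0))).comp (τ : ℂ) h1
    refine h3.congr_deriv ?_
    rw [UpperHalfPlane.ofComplex_apply, show N - 2 = N - 1 - 1 by ring, zpow_sub_one₀ h0 (N - 1)]
    field_simp
  have h5 := h2.smul (γ.hasTauDeriv_comp_smul hg τ)
  refine h5.congr_deriv ?_
  simp only [UpperHalfPlane.ofComplex_apply]
  rw [add_comm, smul_smul, ← zpow_add₀ h0, sub_eq_add_neg N 4]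

end Mp

/-- The coefficients in the formula for the iterated derivative of a slashed function. -/
def slashCoeff (κ c : ℂ) (m r : ℕ) : ℂ :=
  (m.choose r : ℂ) * gammaQuot (κ + r) (m - r) * (-c) ^ (m - r)

theorem slashCoeff_of_lt (κ c : ℂ) {m r : ℕ} (h : m < r) : slashCoeff κ c m r = 0 := by
  simp [slashCoeff, Nat.choose_eq_zero_of_lt h]

theorem slashCoeff_succ_zero (κ c : ℂ) (m : ℕ) :
    slashCoeff κ c (m + 1) 0 = slashCoeff κ c m 0 * (-(κ + m) * c) := by
  simp [slashCoeff, gammaQuot_succ, pow_succ]; ring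

/-- This is one differentiation in `τ`: the first term comes from the power of the root, the second
from the derivative of `g` at `γτ`. -/
theorem slashCoeff_succ_succ (κ c : ℂ) (m r : ℕ) :
    slashCoeff κ c (m + 1) (r + 1) =
      slashCoeff κ c m (r + 1) * (-(κ + m + (r + 1)) * c) + slashCoeff κ c m r := by
  rcases lt_trichotomy m r with h | rfl | h
  · rw [slashCoeff_of_lt _ _ h, slashCoeff_of_lt _ _ (by omega), slashCoeff_of_lt _ _ (by omega)]
    ring
  · simp [slashCoeff, gammaQuot_zero]
  · obtain ⟨t, rfl⟩ := Nat.exists_eq_add_of_lt h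
    have e1 : r + t + 1 + 1 - (r + 1) = t + 1 := by omega
    have e2 : r + t + 1 - (r + 1) = t := by omega
    have e3 : r + t + 1 - r = t + 1 := by omega
    have hc : ((r + t + 1).choose (r + 1) : ℂ) * (r + 1) =
        ((r + t + 1).choose r : ℂ) * (t + 1) := by
      have := Nat.choose_succ_right_eq (r + t + 1) r
      rw [e3] at this
      exact_mod_cast this
    simp only [slashCoeff, e1, e2, e3]
    rw [Nat.choose_succ_succ, gammaQuot_succ, gammaQuot_succ', pow_succ]
    push_cast
    rw [show κ + (r : ℂ) + 1 = κ + (r + 1) by ring]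
    linear_combination gammaQuot (κ + (r + 1)) t * (-c) ^ t * c * hc

/-- The explicit form of the `m`-th derivative of `root ^ (-κ₂) • g (γ τ)`. -/
def slashDeriv (κ₂ : ℤ) (γ : Mp) (g : ℍ → W) (m : ℕ) (τ : ℍ) : W :=
  ∑ r ∈ Finset.range (m + 1), (slashCoeff ((κ₂ : ℂ) / 2) (γ.mat 1 0 : ℂ) m r *
    γ.root τ ^ (-(κ₂ + 2 * m + 2 * r))) • derivTau r g (γ.mat • τ)

theorem hasTauDeriv_slashDeriv [CompleteSpace W] (κ₂ : ℤ) (γ : Mp) {g : ℍ → W} (hg : IsHolTau g)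
    (m : ℕ) : HasTauDeriv (slashDeriv κ₂ γ g m) (slashDeriv κ₂ γ g (m + 1)) := by
  have h := HasTauDeriv.sum (s := Finset.range (m + 1)) fun r _ =>
    (γ.hasTauDeriv_zpow_smul_comp (-(κ₂ + 2 * m + 2 * r)) (hg.hasTauDeriv r)).const_smul
      (slashCoeff ((κ₂ : ℂ) / 2) (γ.mat 1 0 : ℂ) m r)
  have e1 : (fun τ => ∑ r ∈ Finset.range (m + 1), slashCoeff ((κ₂ : ℂ) / 2) (γ.mat 1 0 : ℂ) m r •
      γ.root τ ^ (-(κ₂ + 2 * m + 2 * r) : ℤ) • derivTau r g (γ.mat • τ)) = slashDeriv κ₂ γ g m := by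
    funext τ; simp only [slashDeriv, smul_smul]
  rw [e1] at h
  convert h using 1
  funext τ
  simp only [smul_add, Finset.sum_add_distrib]
  rw [slashDeriv]
  set a : ℕ → ℕ → ℂ := slashCoeff ((κ₂ : ℂ) / 2) (γ.mat 1 0 : ℂ) with ha
  have hA : ∑ r ∈ Finset.range (m + 1), a m r •
      (((-(κ₂ + 2 * m + 2 * r) : ℤ) / 2 : ℂ) * (γ.mat 1 0 : ℂ) *
        γ.root τ ^ (-(κ₂ + 2 * m + 2 * r) - 2 : ℤ)) • derivTau r g (γ.mat • τ) =
      ∑ r ∈ Finset.range (m + 2), (a m r * (-((κ₂ : ℂ) / 2 + m + r) * (γ.mat 1 0 : ℂ)) *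
        γ.root τ ^ (-(κ₂ + 2 * (m + 1 : ℕ) + 2 * r) : ℤ)) • derivTau r g (γ.mat • τ) := by
    -- The added term `r = m + 1` has coefficient zero; it brings the sum to the length of the next
    -- order.
    rw [Finset.sum_range_succ _ (m + 1), ha, slashCoeff_of_lt _ _ (Nat.lt_succ_self m)]
    simp only [zero_mul, zero_smul, add_zero]
    refine Finset.sum_congr rfl fun r _ => ?_
    rw [smul_smul]
    congr 1
    rw [show (-(κ₂ + 2 * m + 2 * r) - 2 : ℤ) = -(κ₂ + 2 * (m + 1 : ℕ) + 2 * r) by push_cast; ring]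
    push_cast
    ring
  have hB : ∑ r ∈ Finset.range (m + 1), a m r •
      γ.root τ ^ (-(κ₂ + 2 * m + 2 * r) - 4 : ℤ) • derivTau (r + 1) g (γ.mat • τ) =
      ∑ r ∈ Finset.range (m + 1), (a m r *
        γ.root τ ^ (-(κ₂ + 2 * (m + 1 : ℕ) + 2 * (r + 1 : ℕ)) : ℤ)) •
          derivTau (r + 1) g (γ.mat • τ) := by
    refine Finset.sum_congr rfl fun r _ => ?_
    rw [smul_smul]
    congr 3
    push_cast; ring
  rw [hA, hB, Finset.sum_range_succ' _ (m + 1), Finset.sum_range_succ' _ (m + 1),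
    add_right_comm (Finset.sum (Finset.range (m + 1)) _) _ (Finset.sum _ _),
    ← Finset.sum_add_distrib]
  congr 1
  · refine Finset.sum_congr rfl fun r _ => ?_
    rw [← add_smul, ← add_mul, ha, slashCoeff_succ_succ]
    push_cast
    rfl
  · rw [ha, slashCoeff_succ_zero]
    simp

theorem derivTau_modularSlash [CompleteSpace W] (κ₂ : ℤ) (γ : Mp) {g : ℍ → W} (hg : IsHolTau g)
    (m : ℕ) : derivTau m (modularSlash κ₂ g γ) = slashDeriv κ₂ γ g m := by
  have h0 : modularSlash κ₂ g γ = slashDeriv κ₂ γ g 0 := by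
    funext τ
    simp [modularSlash, slashDeriv, slashCoeff, gammaQuot_zero, derivTau_zero]
  rw [h0]
  exact derivTau_eq_of_hasTauDeriv (hasTauDeriv_slashDeriv κ₂ γ hg) m

theorem IsHolTau.modularSlash [CompleteSpace W] (κ₂ : ℤ) (γ : Mp) {g : ℍ → W} (hg : IsHolTau g) :
    IsHolTau (modularSlash κ₂ g γ) := by
  have h := γ.hasTauDeriv_zpow_smul_comp (-κ₂) (hg.hasTauDeriv 0)
  simp only [derivTau_zero] at h
  exact h.isHolTau

/-! ### The one-variable combination -/

/-- The modified `d`-th Taylor coefficient of a power series in one variable with coefficients `g`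
and quadratic exponent `A`. -/
def taylorComb₁ (k₂ : ℤ) (A : ℂ) (d : ℕ) (g : ℕ → ℍ → W) (τ : ℍ) : W :=
  ∑ m ∈ Finset.range (d / 2 + 1), (A ^ m / (m.factorial : ℂ) *
    gammaQuot ((k₂ : ℂ) / 2 + d - 1 - (d / 2 : ℕ)) (d / 2 - m)) • derivTau m (g (d - 2 * m)) τ

/-- The `d`-th Taylor coefficient in `u` of the product of `root ^ (-k₂)`, of
`exp (A c u² / (c τ + d))` and of `∑ g_j(γ τ) (u / (c τ + d)) ^ j`. -/
def slashSeries (k₂ : ℤ) (A : ℂ) (γ : Mp) (g : ℕ → ℍ → W) (d : ℕ) (τ : ℍ) : W :=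
  ∑ l ∈ Finset.range (d / 2 + 1), ((A * (γ.mat 1 0 : ℂ)) ^ l / (l.factorial : ℂ)) •
    modularSlash (k₂ + 2 * (d - l)) (g (d - 2 * l)) γ τ

/-- Expand the `m`-th derivatives of the slashed terms and collect by `M = m + i`, which fixes the
function `g (d - 2 * M)`, and by the order `r` of its derivative. The factors `A ^ M`, `c ^ (M - r)`
and the power of the root depend only on `M` and `r`, so the sum over `m` is purely numerical. By
`sum_gammaQuot_mul_choose` only `r = M` survives, and that term is free of `c`. -/
theorem taylorComb₁_slashSeries [CompleteSpace W] (k₂ : ℤ) (A : ℂ) (γ : Mp) {g : ℕ → ℍ → W}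
    (hg : ∀ j, IsHolTau (g j)) (d : ℕ) :
    taylorComb₁ k₂ A d (slashSeries k₂ A γ g) =
      modularSlash (k₂ + 2 * d) (taylorComb₁ k₂ A d g) γ := by
  funext τ
  set l := d / 2 with hl
  set c : ℂ := (γ.mat 1 0 : ℂ) with hc
  set y : ℂ := (k₂ : ℂ) / 2 + d - 1 with hy
  have h1 : taylorComb₁ k₂ A d (slashSeries k₂ A γ g) τ =
      ∑ m ∈ Finset.range (l + 1), ∑ i ∈ Finset.range (l + 1 - m),
        (A ^ m / (m.factorial : ℂ) * gammaQuot (y - l) (l - m) *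
          ((A * c) ^ i / (i.factorial : ℂ))) •
          slashDeriv (k₂ + 2 * ((d - 2 * m : ℕ) - i)) γ (g (d - 2 * (m + i))) m τ := by
    rw [taylorComb₁]
    refine Finset.sum_congr rfl fun m hm => ?_
    have hm' : m ≤ l := Nat.lt_succ_iff.1 (Finset.mem_range.1 hm)
    rw [← hl, ← hy]
    have e0 : slashSeries k₂ A γ g (d - 2 * m) = fun τ =>
        ∑ i ∈ Finset.range (l + 1 - m), ((A * c) ^ i / (i.factorial : ℂ)) •
          modularSlash (k₂ + 2 * ((d - 2 * m : ℕ) - i)) (g (d - 2 * (m + i))) γ τ := by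
      funext τ
      rw [slashSeries, show (d - 2 * m) / 2 + 1 = l + 1 - m by omega]
      refine Finset.sum_congr rfl fun i _ => ?_
      rw [show d - 2 * m - 2 * i = d - 2 * (m + i) by omega]
    rw [e0, derivTau_sum_const_smul _ _ fun i _ => (hg _).modularSlash _ _, Finset.smul_sum]
    refine Finset.sum_congr rfl fun i _ => ?_
    rw [derivTau_modularSlash _ _ (hg _), smul_smul]
  rw [h1]
  rw [← Finset.sum_range_diag_flip (l + 1) fun m i =>
    (A ^ m / (m.factorial : ℂ) * gammaQuot (y - l) (l - m) *
          ((A * c) ^ i / (i.factorial : ℂ))) •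
          slashDeriv (k₂ + 2 * ((d - 2 * m : ℕ) - i)) γ (g (d - 2 * (m + i))) m τ]
  rw [modularSlash, taylorComb₁, Finset.smul_sum]
  refine Finset.sum_congr rfl fun M hM => ?_
  have hM' : M ≤ l := Nat.lt_succ_iff.1 (Finset.mem_range.1 hM)
  have h2 : ∀ m ∈ Finset.range (M + 1),
      (A ^ m / (m.factorial : ℂ) * gammaQuot (y - l) (l - m) *
          ((A * c) ^ (M - m) / ((M - m).factorial : ℂ))) •
          slashDeriv (k₂ + 2 * ((d - 2 * m : ℕ) - (M - m : ℕ))) γ (g (d - 2 * (m + (M - m)))) m τ =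
      ∑ r ∈ Finset.range (M + 1), (gammaQuot (y - l) (l - m) / (m.factorial : ℂ) *
      (1 / ((M - m).factorial : ℂ)) * ((m.choose r : ℂ) *
        gammaQuot (y + 1 - m - M + r) (m - r) * (-1) ^ (m - r))) •
        ((A ^ M * c ^ (M - r) * γ.root τ ^ (-(k₂ + 2 * (d - M + r) : ℤ))) •
          derivTau r (g (d - 2 * M)) (γ.mat • τ)) := by
    intro m hm
    have hm' : m ≤ M := Nat.lt_succ_iff.1 (Finset.mem_range.1 hm)
    -- Padding with the zero coefficients for `r > m` makes the range of `r` independent of `m`, so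
    -- the sums can be exchanged.
    have hsub : Finset.range (m + 1) ⊆ Finset.range (M + 1) :=
      Finset.range_subset_range.2 (by omega)
    rw [show m + (M - m) = M by omega, slashDeriv, Finset.sum_subset hsub, Finset.smul_sum]
    swap
    · intro r _ hr
      rw [slashCoeff_of_lt _ _ (by simpa using hr), zero_mul, zero_smul]
    refine Finset.sum_congr rfl fun r hr => ?_
    rw [smul_smul, smul_smul]
    rcases lt_or_ge m r with hmr | hmr
    · rw [slashCoeff_of_lt _ _ hmr, Nat.choose_eq_zero_of_lt hmr]
      simp
    congr 1
    have e1 : (-(k₂ + 2 * ((d - 2 * m : ℕ) - (M - m : ℕ)) + 2 * m + 2 * r) : ℤ) =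
        -(k₂ + 2 * (d - M + r) : ℤ) := by
      have : 2 * m ≤ d := by omega
      push_cast [hm', this]; ring
    have e2 : ((k₂ + 2 * ((d - 2 * m : ℕ) - (M - m : ℕ)) : ℤ) : ℂ) / 2 + r = y + 1 - m - M + r := by
      have : 2 * m ≤ d := by omega
      rw [hy]
      push_cast [hm', this]; ring
    rw [e1, slashCoeff, e2, neg_pow c, mul_pow, show A ^ M = A ^ m * A ^ (M - m) by
      rw [← pow_add]; congr 1; omega, show c ^ (M - r) = c ^ (M - m) * c ^ (m - r) by
      rw [← pow_add]; congr 1; omega]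
    ring
  rw [Finset.sum_congr rfl h2, Finset.sum_comm]
  simp only [← Finset.sum_smul]
  rw [Finset.sum_congr rfl fun r hr => by
    rw [sum_gammaQuot_mul_choose hM' (Nat.lt_succ_iff.1 (Finset.mem_range.1 hr)) y]]
  simp only [ite_smul, zero_smul]
  rw [Finset.sum_ite_eq' (Finset.range (M + 1)) M, if_pos (Finset.self_mem_range_succ M),
    smul_smul, smul_smul, Nat.sub_self, pow_zero, mul_one, ← hl, ← hy]
  congr 1
  rw [show (d : ℤ) - M + M = d by ring]
  ring

/-! ### Uniqueness of power series coefficients -/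

/-- The formal power series in one variable with coefficients `a`. -/
def coeffSeries (a : ℕ → W) : FormalMultilinearSeries ℂ ℂ W := fun d =>
  ContinuousMultilinearMap.mkPiRing ℂ (Fin d) (a d)

theorem coeff_coeffSeries (a : ℕ → W) (d : ℕ) : (coeffSeries a).coeff d = a d := by
  simp [coeffSeries, FormalMultilinearSeries.coeff]

theorem powerSeries_coeff_unique {F : ℂ → W} {a a' : ℕ → W}
    (h : ∀ u, HasSum (fun d => u ^ d • a d) (F u))
    (h' : ∀ u, HasSum (fun d => u ^ d • a' d) (F u)) :
    a = a' := by
  have key : ∀ a : ℕ → W, (∀ u, HasSum (fun d => u ^ d • a d) (F u)) →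
      HasFPowerSeriesAt F (coeffSeries a) 0 := by
    intro a h
    rw [hasFPowerSeriesAt_iff]
    refine Filter.Eventually.of_forall fun u => ?_
    simpa only [coeff_coeffSeries, zero_add] using h u
  have := (key a h).eq_formalMultilinearSeries (key a' h')
  funext d
  rw [← coeff_coeffSeries a, this, coeff_coeffSeries]

theorem hasSum_fiberwise_degree [CompleteSpace W] {ι : Type*} {deg : ι → ℕ} {S : ℕ → Finset ι}
    (hS : ∀ d i, i ∈ S d ↔ deg i = d) {a : ι → W} {u : ℂ} {w : W}
    (h : HasSum (fun i => u ^ deg i • a i) w) : HasSum (fun d => u ^ d • ∑ i ∈ S d, a i) w := by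
  have h1 := h.tsum_fiberwise deg
  convert h1 using 2 with d
  have e1 : deg ⁻¹' {d} = (S d : Set ι) := by
    ext i; simp [hS]
  rw [e1, Finset.tsum_subtype' (S d) fun i => u ^ deg i • a i, Finset.smul_sum]
  exact Finset.sum_congr rfl fun i hi => by rw [(hS d i).1 hi]

/-- Linear functionals reduce this to scalar coefficients, where a polynomial that vanishes at every
point of `ℂ ^ n` is zero. -/
theorem eq_zero_of_forall_sum_monomial {n : ℕ} {S : Finset (Fin n → ℕ)} {a : (Fin n → ℕ) → W}
    (h : ∀ z : Fin n → ℂ, ∑ p ∈ S, (∏ i, z i ^ p i) • a p = 0) {p : Fin n → ℕ} (hp : p ∈ S) :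
    a p = 0 := by
  rw [← Module.forall_dual_apply_eq_zero_iff ℂ]
  intro f
  set P : MvPolynomial (Fin n) ℂ :=
    ∑ p ∈ S, MvPolynomial.monomial (Finsupp.equivFunOnFinite.symm p) (f (a p)) with hP
  have hP0 : P = 0 := by
    refine MvPolynomial.funext fun z => ?_
    have := congrArg f (h z)
    rw [map_sum, map_zero] at this
    rw [hP, map_sum, map_zero, ← this]
    refine Finset.sum_congr rfl fun q _ => ?_
    rw [MvPolynomial.eval_monomial, map_smul, smul_eq_mul, mul_comm,
      Finsupp.prod_fintype _ _ fun i => pow_zero _]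
    simp
  have := congrArg (MvPolynomial.coeff (Finsupp.equivFunOnFinite.symm p)) hP0
  rw [hP, MvPolynomial.coeff_sum, Finset.sum_eq_single p] at this
  · simpa using this
  · intro q _ hq
    rw [MvPolynomial.coeff_monomial, if_neg]
    simpa using hq
  · exact fun h => absurd hp h

/-! ### Homogeneous parts -/

/-- The homogeneous part of degree `d` at `z` of a family of Taylor coefficients. -/
def homogPart {n : ℕ} (h : (Fin n → ℕ) → ℍ → W) (z : Fin n → ℂ) (d : ℕ) (τ : ℍ) : W :=
  ∑ p ∈ Finset.piAntidiag Finset.univ d, (∏ i, z i ^ p i) • h p τ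

theorem mem_piAntidiag_univ {ι : Type*} [Fintype ι] [DecidableEq ι] {d : ℕ} {p : ι → ℕ} :
    p ∈ Finset.piAntidiag Finset.univ d ↔ ∑ i, p i = d := by simp

theorem eq_of_forall_homogPart_eq {n : ℕ} {h h' : (Fin n → ℕ) → ℍ → W} {τ τ' : ℍ}
    (H : ∀ z d, homogPart h z d τ = homogPart h' z d τ') (p : Fin n → ℕ) : h p τ = h' p τ' := by
  rw [← sub_eq_zero]
  refine eq_zero_of_forall_sum_monomial (S := Finset.piAntidiag Finset.univ (∑ i, p i))
    (a := fun p => h p τ - h' p τ') (fun z => ?_) (mem_piAntidiag_univ.2 rfl)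
  simp only [smul_sub, Finset.sum_sub_distrib]
  exact sub_eq_zero.2 (H z _)

theorem IsTaylorExpansion.hasSum_homogPart [CompleteSpace W] {n : ℕ} {b : Module.Basis (Fin n) ℝ V}
    {φ : ℍ → ℂ ⊗[ℝ] V → W} {h : (Fin n → ℕ) → ℍ → W} (hh : IsTaylorExpansion b φ h)
    (τ : ℍ) (z : Fin n → ℂ) (u : ℂ) :
    HasSum (fun d => u ^ d • homogPart h z d τ) (φ τ (u • ∑ i, z i ⊗ₜ[ℝ] b i)) := by
  have h1 := hh τ fun i => u * z i
  have e1 : ∑ i, (u * z i) ⊗ₜ[ℝ] b i = u • ∑ i, z i ⊗ₜ[ℝ] b i := by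
    simp only [Finset.smul_sum, TensorProduct.smul_tmul', smul_eq_mul]
  rw [e1] at h1
  refine hasSum_fiberwise_degree (deg := fun p : Fin n → ℕ => ∑ i, p i)
    (fun d p => mem_piAntidiag_univ) ?_
  convert h1 using 2 with p
  rw [smul_smul]
  simp only [mul_pow, Finset.prod_mul_distrib, Finset.prod_pow_eq_pow_sum]

theorem IsTaylorExpansion.unique [CompleteSpace W] {n : ℕ} {b : Module.Basis (Fin n) ℝ V}
    {φ : ℍ → ℂ ⊗[ℝ] V → W} {h h' : (Fin n → ℕ) → ℍ → W} (hh : IsTaylorExpansion b φ h)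
    (hh' : IsTaylorExpansion b φ h') : h = h' := by
  funext p τ
  refine eq_of_forall_homogPart_eq (fun z d => ?_) p
  exact congrFun (powerSeries_coeff_unique (fun u => hh.hasSum_homogPart τ z u)
    fun u => hh'.hasSum_homogPart τ z u) d

theorem isHolTau_homogPart {n : ℕ} {h : (Fin n → ℕ) → ℍ → W} (hol : ∀ p, IsHolTau (h p))
    (z : Fin n → ℂ) (d : ℕ) : IsHolTau (homogPart h z d) :=
  IsHolTau.sum_const_smul _ _ fun p _ => hol p

/-! ### The slash operator on Taylor coefficients -/

/-- The element `(γ, [0, 0], 1)` of the Jacobi group. -/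
def ofMp (L : IntegralLattice V) (γ : Mp) : JacobiGroup L := ⟨γ, 0, 0, 1⟩

theorem ofMp_mem (L : IntegralLattice V) (γ : Mp) : ofMp L γ ∈ jacobiSubgroup L ⊤ :=
  ⟨Subgroup.mem_top _, zero_mem _, zero_mem _, one_pow _⟩

theorem formC_sum_tmul (L : IntegralLattice V) {n : ℕ} (b : Module.Basis (Fin n) ℝ V)
    (z z' : Fin n → ℂ) :
    L.formC (∑ i, z i ⊗ₜ[ℝ] b i) (∑ i, z' i ⊗ₜ[ℝ] b i) =
      ∑ i, ∑ j, z i * z' j * (L.form (b i) (b j) : ℂ) := by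
  simp only [IntegralLattice.formC, map_sum, LinearMap.coe_sum, Finset.sum_apply,
    LinearMap.BilinForm.baseChange_tmul]
  rw [Finset.sum_comm]
  refine Finset.sum_congr rfl fun i _ => Finset.sum_congr rfl fun j _ => ?_
  simp [mul_comm]

/-- The exponent `A = -π i ∑ G_ij z_i z_j`. -/
def gramExp (L : IntegralLattice V) {n : ℕ} (b : Module.Basis (Fin n) ℝ V) (z : Fin n → ℂ) : ℂ :=
  ∑ i, ∑ j, -Real.pi * Complex.I * L.form (b i) (b j) * (z i * z j)

theorem jacobiSlash_ofMp (k₂ : ℤ) (L : IntegralLattice V) (φ : ℍ → ℂ ⊗[ℝ] V → W) (γ : Mp) {n : ℕ}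
    (b : Module.Basis (Fin n) ℝ V) (τ : ℍ) (z : Fin n → ℂ) (u : ℂ) :
    jacobiSlash k₂ φ (ofMp L γ) τ (u • ∑ i, z i ⊗ₜ[ℝ] b i) =
      Complex.exp (gramExp L b z * (γ.mat 1 0 : ℂ) / den γ.mat τ * u ^ 2) •
        γ.root τ ^ (-k₂) • φ (γ.mat • τ) ((u / den γ.mat τ) • ∑ i, z i ⊗ₜ[ℝ] b i) := by
  have hs : ∀ z : ℂ ⊗[ℝ] V, shift τ z (0 : V) 0 = z := by simp [shift]
  simp only [jacobiSlash, jacobiFactor, ofMp, hs, smul_smul]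
  rw [mul_comm (γ.root τ ^ (-k₂)), mul_comm (den γ.mat τ)⁻¹, ← div_eq_mul_inv]
  congr 2
  have hQ : L.QC (u • ∑ i, z i ⊗ₜ[ℝ] b i) =
      u ^ 2 * (∑ i, ∑ j, z i * z j * (L.form (b i) (b j) : ℂ)) / 2 := by
    rw [IntegralLattice.QC, LinearMap.map_smul₂, map_smul, formC_sum_tmul]
    simp only [smul_eq_mul]; ring
  rw [hQ, e, Circle.coe_one, one_mul]
  congr 1
  have hA : gramExp L b z =
      -Real.pi * Complex.I * ∑ i, ∑ j, z i * z j * (L.form (b i) (b j) : ℂ) := by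
    simp only [gramExp, Finset.mul_sum]
    refine Finset.sum_congr rfl fun i _ => Finset.sum_congr rfl fun j _ => by ring
  rw [hA]
  simp [IntegralLattice.Q]
  ring

/-- A Cauchy product of the exponential series with the Taylor series along the line: the term of
index `(m, j)` has degree `2 m + j` in `u`. Finite dimension supplies the absolute convergence that
the product needs. -/
theorem homogPart_slash [CompleteSpace W] [FiniteDimensional ℂ W] {k₂ : ℤ} {L : IntegralLattice V}
    {φ : ℍ → ℂ ⊗[ℝ] V → W} {γ : Mp} {n : ℕ} {b : Module.Basis (Fin n) ℝ V}
    {h h' : (Fin n → ℕ) → ℍ → W} (hh : IsTaylorExpansion b φ h)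
    (hh' : IsTaylorExpansion b (jacobiSlash k₂ φ (ofMp L γ)) h') (z : Fin n → ℂ) :
    homogPart h' z = slashSeries k₂ (gramExp L b z) γ (homogPart h z) := by
  funext d τ
  set A := gramExp L b z
  set c : ℂ := (γ.mat 1 0 : ℂ) with hc
  set j := den γ.mat τ with hj
  have hj0 : j ≠ 0 := den_ne_zero _ _
  refine congrFun (powerSeries_coeff_unique (a := fun d => homogPart h' z d τ)
    (a' := fun d => slashSeries k₂ A γ (homogPart h z) d τ)
    (fun u => hh'.hasSum_homogPart τ z u) fun u => ?_) d
  rw [jacobiSlash_ofMp]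
  have h1 : HasSum (fun m : ℕ => (A * c / j * u ^ 2) ^ m / (m.factorial : ℂ))
      (Complex.exp (A * c / j * u ^ 2)) := by
    rw [Complex.exp_eq_exp_ℂ]
    exact NormedSpace.expSeries_div_hasSum_exp _
  have h2 := (hh.hasSum_homogPart (γ.mat • τ) z (u / j)).const_smul (γ.root τ ^ (-k₂))
  have n2 : Summable fun d : ℕ =>
      ‖γ.root τ ^ (-k₂) • (u / j) ^ d • homogPart h z d (γ.mat • τ)‖ := by
    have : FiniteDimensional ℝ W := FiniteDimensional.complexToReal W
    exact summable_norm_iff.2 h2.summable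
  have h13 := (summable_norm_iff.2 h1.summable).mul_of_nonneg n2 (fun _ => norm_nonneg _)
    fun _ => norm_nonneg _
  have h3 := h1.smul h2 (Summable.of_norm_bounded h13 fun x => (norm_smul_le _ _))
  have h4 : ∀ x : ℕ × ℕ, ((A * c / j * u ^ 2) ^ x.1 / (x.1.factorial : ℂ)) •
      γ.root τ ^ (-k₂) • (u / j) ^ x.2 • homogPart h z x.2 (γ.mat • τ) =
      u ^ (2 * x.1 + x.2) • (((A * c) ^ x.1 / (x.1.factorial : ℂ)) •
        γ.root τ ^ (-(k₂ + 2 * (x.1 + x.2 : ℕ)) : ℤ) • homogPart h z x.2 (γ.mat • τ)) := by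
    intro x
    simp only [smul_smul]
    congr 1
    -- Each factor `1 / (cτ + d)` is two further negative powers of the root: `m` of them come from
    -- the exponential and `j` from the rescaled argument.
    have e1 : γ.root τ ^ (-(k₂ + 2 * (x.1 + x.2 : ℕ)) : ℤ) =
        γ.root τ ^ (-k₂) * (j ^ (x.1 + x.2))⁻¹ := by
      rw [neg_add, zpow_add₀ (γ.root_ne_zero τ), hj, ← γ.root_sq, ← pow_mul, zpow_neg _ (2 * _)]
      norm_cast
    have e2 : (j ^ (x.1 + x.2))⁻¹ = (j⁻¹) ^ x.1 * (j⁻¹) ^ x.2 := by rw [← pow_add, inv_pow]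
    rw [e1, e2]
    simp only [div_eq_mul_inv, mul_pow, pow_add, pow_mul]
    ring
  simp only [h4] at h3
  have h5 := hasSum_fiberwise_degree (deg := fun x : ℕ × ℕ => 2 * x.1 + x.2)
    (S := fun d => (Finset.range (d / 2 + 1)).image fun m => (m, d - 2 * m)) (fun d x => ?_) h3
  · convert h5 using 3 with d
    rw [slashSeries, Finset.sum_image (by intro m _ m' _ hmm; exact (Prod.ext_iff.1 hmm).1)]
    refine Finset.sum_congr rfl fun m hm => ?_
    have hm' : 2 * m ≤ d := by
      have := Nat.lt_succ_iff.1 (Finset.mem_range.1 hm)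
      omega
    rw [modularSlash]
    congr 3
    push_cast [hm']
    ring
  · simp only [Finset.mem_image, Finset.mem_range, Prod.ext_iff]
    constructor
    · rintro ⟨m, hm, h1, h2⟩; omega
    · intro hx; exact ⟨x.1, by omega, rfl, by omega⟩

/-! ### The combination in several variables -/

/-- The matrices of nonnegative integers with entry sum `m`. -/
def matsOfSum (n m : ℕ) : Finset (Fin n → Fin n → ℕ) :=
  (Finset.piAntidiag (Finset.univ : Finset (Fin n × Fin n)) m).map
    (Equiv.curry (Fin n) (Fin n) ℕ).toEmbedding

theorem mem_matsOfSum {n m : ℕ} {Λ : Fin n → Fin n → ℕ} : Λ ∈ matsOfSum n m ↔ matSum Λ = m := by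
  rw [matsOfSum, Finset.mem_map_equiv, mem_piAntidiag_univ, Fintype.sum_prod_type]
  rfl

/-- The coefficient `M ^ Λ / Λ!`. -/
def matCoeff {n : ℕ} (M : Fin n → Fin n → ℂ) (Λ : Fin n → Fin n → ℕ) : ℂ :=
  ∏ i, ∏ j, M i j ^ Λ i j / ((Λ i j).factorial : ℂ)

/-- The multinomial theorem over the `n²` index pairs; dividing by `m!` turns the multinomial
coefficient into `1 / Λ!`. -/
theorem pow_div_factorial_eq_sum_matCoeff {n : ℕ} (M : Fin n → Fin n → ℂ) (m : ℕ) :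
    (∑ i, ∑ j, M i j) ^ m / (m.factorial : ℂ) = ∑ Λ ∈ matsOfSum n m, matCoeff M Λ := by
  rw [← Fintype.sum_prod_type', Finset.sum_pow_eq_sum_piAntidiag, Finset.sum_div, matsOfSum,
    Finset.sum_map]
  refine Finset.sum_congr rfl fun k hk => ?_
  have hs : ∑ x, k x = m := mem_piAntidiag_univ.1 hk
  have hspec := Nat.multinomial_spec Finset.univ k
  rw [hs] at hspec
  have hm : (m.factorial : ℂ) = (∏ x, ((k x).factorial : ℂ)) * Nat.multinomial Finset.univ k := by
    rw [← hspec]; push_cast; rfl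
  have h0 : (∏ x, ((k x).factorial : ℂ)) ≠ 0 :=
    Finset.prod_ne_zero_iff.2 fun x _ => by exact_mod_cast Nat.factorial_ne_zero _
  have h1 : (Nat.multinomial Finset.univ k : ℂ) ≠ 0 := by
    exact_mod_cast (Nat.multinomial_pos _ _).ne'
  have h2 : matCoeff M ((Equiv.curry (Fin n) (Fin n) ℕ).toEmbedding k) =
      (∏ x : Fin n × Fin n, M x.1 x.2 ^ k x) / ∏ x, ((k x).factorial : ℂ) := by
    rw [← Finset.prod_div_distrib, Fintype.prod_prod_type]
    rfl
  rw [h2, hm]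
  field_simp

/-- An entry at `(i, j)` contributes `z i * z j`, so `z i` collects its row sum and its column sum.
This is the origin of `matPi`. -/
theorem matCoeff_mul_monomial {n : ℕ} (M : Fin n → Fin n → ℂ) (z : Fin n → ℂ)
    (Λ : Fin n → Fin n → ℕ) :
    matCoeff (fun i j => M i j * (z i * z j)) Λ = matCoeff M Λ * ∏ i, z i ^ matPi Λ i := by
  have h : ∏ i, z i ^ matPi Λ i = ∏ i, ∏ j, (z i * z j) ^ Λ i j := by
    simp only [matPi, pow_add, Finset.prod_mul_distrib, mul_pow, ← Finset.prod_pow_eq_pow_sum]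
    congr 1
    exact Finset.prod_comm
  rw [h, matCoeff, matCoeff, ← Finset.prod_mul_distrib]
  refine Finset.prod_congr rfl fun i _ => ?_
  rw [← Finset.prod_mul_distrib]
  refine Finset.prod_congr rfl fun j _ => ?_
  rw [mul_pow]; ring

theorem sum_matPi {n : ℕ} (Λ : Fin n → Fin n → ℕ) : ∑ i, matPi Λ i = 2 * matSum Λ := by
  simp only [matPi, Finset.sum_add_distrib, matSum]
  rw [Finset.sum_comm (f := fun i j => Λ j i)]
  ring

/-- The matrix sum in several variables is the one-variable combination along a line, with the power
of the quadratic exponent expanded. -/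
theorem homogPart_taylorCombination [CompleteSpace W] {n : ℕ} (Gram : Fin n → Fin n → ℝ)
    {h : (Fin n → ℕ) → ℍ → W} (hol : ∀ p, IsHolTau (h p)) (k₂ : ℤ) (d : ℕ) (z : Fin n → ℂ) :
    homogPart (fun p =>
        taylorCombination Gram ((k₂ : ℂ) / 2 + d - 1 - (d / 2 : ℕ)) (d / 2) p h) z d =
      fun τ => ((4 : ℂ) ^ (d / 2) * (d / 2).factorial) •
        taylorComb₁ k₂ (∑ i, ∑ j, -Real.pi * Complex.I * Gram i j * (z i * z j)) d
          (homogPart h z) τ := by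
  funext τ
  set l := d / 2 with hl
  set x : ℂ := (k₂ : ℂ) / 2 + d - 1 - (l : ℕ) with hx
  set M : Fin n → Fin n → ℂ := fun i j => -Real.pi * Complex.I * Gram i j with hM
  have hL : homogPart (fun p => taylorCombination Gram x l p h) z d τ =
      ((4 : ℂ) ^ l * l.factorial) • ∑ p ∈ Finset.piAntidiag Finset.univ d, ∑ Λ ∈ matIndex l p,
        (gammaQuot x (l - matSum Λ) * matCoeff M Λ * ∏ i, z i ^ p i) •
          derivTau (matSum Λ) (h fun i => p i - matPi Λ i) τ := by
    rw [homogPart, Finset.smul_sum]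
    refine Finset.sum_congr rfl fun p _ => ?_
    rw [taylorCombination, smul_comm, Finset.smul_sum]
    congr 1
    refine Finset.sum_congr rfl fun Λ _ => ?_
    rw [smul_smul]
    congr 1
    simp only [matCoeff, hM]
    ring
  have hR : taylorComb₁ k₂ (∑ i, ∑ j, M i j * (z i * z j)) d (homogPart h z) τ =
      ∑ m ∈ Finset.range (l + 1), ∑ y ∈ matsOfSum n m ×ˢ
        (Finset.piAntidiag Finset.univ (d - 2 * m) : Finset (Fin n → ℕ)),
        (gammaQuot x (l - m) * matCoeff M y.1 * ∏ i, z i ^ (y.2 i + matPi y.1 i)) •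
          derivTau m (h y.2) τ := by
    rw [taylorComb₁]
    refine Finset.sum_congr rfl fun m _ => ?_
    have e1 : derivTau m (homogPart h z (d - 2 * m)) τ =
        ∑ q ∈ Finset.piAntidiag Finset.univ (d - 2 * m), (∏ i, z i ^ q i) • derivTau m (h q) τ :=
      congrFun (derivTau_sum_const_smul _ (fun q : Fin n → ℕ => ∏ i, z i ^ q i)
        (fun q _ => hol q) m) τ
    rw [e1, pow_div_factorial_eq_sum_matCoeff, Finset.sum_product, Finset.sum_mul, Finset.sum_smul]
    refine Finset.sum_congr rfl fun Λ _ => ?_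
    rw [Finset.smul_sum]
    refine Finset.sum_congr rfl fun q _ => ?_
    rw [matCoeff_mul_monomial, smul_smul]
    congr 1
    simp only [pow_add, Finset.prod_mul_distrib, hl, hx]
    ring
  rw [hL, hR, Finset.sum_sigma', Finset.sum_sigma']
  congr 1
  -- The condition `matPi Λ ≤ p` in `matIndex` makes the truncated subtraction exact, so `(p, Λ) ↦
  -- (Λ, p - π(Λ))` is invertible.
  refine Finset.sum_bij' (fun y _ => ⟨matSum y.2, y.2, fun i => y.1 i - matPi y.2 i⟩)
    (fun y _ => ⟨fun i => y.2.2 i + matPi y.2.1 i, y.2.1⟩) ?_ ?_ ?_ ?_ ?_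
  · rintro ⟨p, Λ⟩ hy
    rw [Finset.mem_sigma, mem_piAntidiag_univ, mem_matIndex] at hy
    obtain ⟨hp, hs, hle⟩ := hy
    simp only at hp hs hle
    simp only [Finset.mem_sigma, Finset.mem_range, Finset.mem_product, mem_matsOfSum, true_and,
      mem_piAntidiag_univ]
    refine ⟨by omega, ?_⟩
    have := Finset.sum_tsub_distrib Finset.univ (fun i _ => hle i)
    rw [this, hp, sum_matPi]
  · rintro ⟨m, Λ, q⟩ hy
    simp only [Finset.mem_sigma, Finset.mem_range, Finset.mem_product, mem_matsOfSum,
      mem_piAntidiag_univ] at hy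
    obtain ⟨hm, hs, hq⟩ := hy
    simp only [Finset.mem_sigma, mem_piAntidiag_univ, mem_matIndex, Finset.sum_add_distrib,
      sum_matPi, hs, hq]
    refine ⟨by omega, by omega, fun i => Nat.le_add_left _ _⟩
  · rintro ⟨p, Λ⟩ hy
    rw [Finset.mem_sigma, mem_piAntidiag_univ, mem_matIndex] at hy
    obtain ⟨hp, hs, hle⟩ := hy
    simp only [Sigma.mk.injEq, heq_eq_eq, and_true]
    funext i
    exact Nat.sub_add_cancel (hle i)
  · rintro ⟨m, Λ, q⟩ hy
    simp only [Finset.mem_sigma, Finset.mem_range, Finset.mem_product, mem_matsOfSum,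
      mem_piAntidiag_univ] at hy
    obtain ⟨hm, rfl, hq⟩ := hy
    simp
  · rintro ⟨p, Λ⟩ hy
    rw [Finset.mem_sigma, mem_piAntidiag_univ, mem_matIndex] at hy
    obtain ⟨hp, hs, hle⟩ := hy
    simp only at hle ⊢
    congr 2
    refine Finset.prod_congr rfl fun i _ => ?_
    rw [Nat.sub_add_cancel (hle i)]

/-- Both parities of `d` give the same argument `k + d - 1 - ⌊d / 2⌋`, so the case split disappears.
-/
theorem modifiedTaylor_eq (k₂ : ℤ) (L : IntegralLattice V) {n : ℕ} (b : Module.Basis (Fin n) ℝ V)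
    {p : Fin n → ℕ} {d : ℕ} (hp : ∑ i, p i = d) (h : (Fin n → ℕ) → ℍ → W) :
    modifiedTaylor k₂ L b p h = taylorCombination (fun i j => L.form (b i) (b j))
      ((k₂ : ℂ) / 2 + d - 1 - (d / 2 : ℕ)) (d / 2) p h := by
  rw [modifiedTaylor, hp]
  congr 1
  split_ifs with he
  · obtain ⟨l, rfl⟩ := he
    rw [show (l + l) / 2 = l by omega]
    push_cast; ring
  · obtain ⟨l, rfl⟩ := Nat.not_even_iff_odd.1 he
    rw [show (2 * l + 1) / 2 = l by omega]
    push_cast; ring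

theorem homogPart_modifiedTaylor [CompleteSpace W] (k₂ : ℤ) (L : IntegralLattice V) {n : ℕ}
    (b : Module.Basis (Fin n) ℝ V) {h : (Fin n → ℕ) → ℍ → W} (hol : ∀ p, IsHolTau (h p))
    (d : ℕ) (z : Fin n → ℂ) :
    homogPart (fun p => modifiedTaylor k₂ L b p h) z d =
      fun τ => ((4 : ℂ) ^ (d / 2) * (d / 2).factorial) •
        taylorComb₁ k₂ (gramExp L b z) d (homogPart h z) τ := by
  rw [gramExp, ← homogPart_taylorCombination (fun i j => L.form (b i) (b j)) hol]
  funext τ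
  refine Finset.sum_congr rfl fun p hp => ?_
  beta_reduce
  rw [modifiedTaylor_eq k₂ L b (mem_piAntidiag_univ.1 hp)]

/-- The modified Taylor coefficients of a slashed function are the slashed modified Taylor
coefficients. -/
theorem modifiedTaylor_slash [CompleteSpace W] [FiniteDimensional ℂ W] {k₂ : ℤ}
    {L : IntegralLattice V} {φ : ℍ → ℂ ⊗[ℝ] V → W} {γ : Mp} {n : ℕ} {b : Module.Basis (Fin n) ℝ V}
    {h h' : (Fin n → ℕ) → ℍ → W} (hh : IsTaylorExpansion b φ h)
    (hh' : IsTaylorExpansion b (jacobiSlash k₂ φ (ofMp L γ)) h') (hol : ∀ p, IsHolTau (h p))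
    (hol' : ∀ p, IsHolTau (h' p)) (p : Fin n → ℕ) :
    modifiedTaylor k₂ L b p h' =
      modularSlash (k₂ + 2 * ∑ i, (p i : ℤ)) (modifiedTaylor k₂ L b p h) γ := by
  funext τ
  rw [← sub_eq_zero]
  refine eq_zero_of_forall_sum_monomial (S := Finset.piAntidiag Finset.univ (∑ i, p i))
    (a := fun p => modifiedTaylor k₂ L b p h' τ -
      modularSlash (k₂ + 2 * ∑ i, (p i : ℤ)) (modifiedTaylor k₂ L b p h) γ τ) (fun z => ?_)
    (mem_piAntidiag_univ.2 rfl)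
  set d := ∑ i, p i
  simp only [smul_sub, Finset.sum_sub_distrib]
  rw [sub_eq_zero]
  have e1 := congrFun (homogPart_modifiedTaylor k₂ L b hol' d z) τ
  have e2 := congrFun (homogPart_modifiedTaylor k₂ L b hol d z) (γ.mat • τ)
  rw [homogPart] at e1 e2
  rw [e1, homogPart_slash hh hh' z, taylorComb₁_slashSeries _ _ _ (isHolTau_homogPart hol z),
    modularSlash, smul_comm, ← e2, Finset.smul_sum]
  refine Finset.sum_congr rfl fun q hq => ?_
  -- The weight depends on the multi-index only through its degree, so one power of the root serves
  -- the whole homogeneous part.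
  have hq' : (d : ℤ) = ∑ i, (q i : ℤ) := by
    rw [← mem_piAntidiag_univ.1 hq]; push_cast; rfl
  rw [modularSlash, smul_comm, hq']

/-! ### Expansions in powers of `q` -/

theorem norm_e (x : ℂ) : ‖e x‖ = Real.exp (-(2 * Real.pi * x.im)) := by
  rw [e, Complex.norm_exp]
  congr 1
  simp

theorem hasDerivAt_e (a s : ℂ) :
    HasDerivAt (fun s => e (a * s)) (2 * Real.pi * Complex.I * a * e (a * s)) s := by
  have h1 : HasDerivAt (fun s => 2 * Real.pi * Complex.I * (a * s))
      (2 * Real.pi * Complex.I * a) s := by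
    simpa using ((hasDerivAt_id s).const_mul a).const_mul (2 * Real.pi * Complex.I : ℂ)
  refine h1.cexp.congr_deriv ?_
  rw [e]
  ring

/-- `f(τ) = ∑ a(m) q^(m / N)`, absolutely convergent everywhere. -/
def HasQSeries (N : ℕ) (a : ℤ → W) (f : ℍ → W) : Prop :=
  ∀ τ : ℍ, HasSum (fun m : ℤ => e (m * τ / N) • a m) (f τ)

theorem summable_norm_of_finiteDimensional [FiniteDimensional ℂ W] {ι : Type*} {f : ι → W}
    (hf : Summable f) : Summable fun i => ‖f i‖ := by
  have : FiniteDimensional ℝ W := FiniteDimensional.complexToReal W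
  exact summable_norm_iff.2 hf

theorem exp_mul_le_add_of_mem_Icc {y₁ y₂ y : ℝ} (h₁ : y₁ ≤ y) (h₂ : y ≤ y₂) (t : ℝ) :
    Real.exp (t * y) ≤ Real.exp (t * y₁) + Real.exp (t * y₂) := by
  rcases le_total 0 t with ht | ht
  · have := Real.exp_le_exp.2 (mul_le_mul_of_nonneg_left h₂ ht)
    linarith [Real.exp_pos (t * y₁)]
  · have := Real.exp_le_exp.2 (mul_le_mul_of_nonpos_left h₁ ht)
    linarith [Real.exp_pos (t * y₂)]

/-- Termwise differentiation by locally uniform convergence. No lower bound on the exponents is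
assumed, so the majorant must serve both signs of `m`. -/
theorem HasQSeries.hasTauDeriv [FiniteDimensional ℂ W] {N : ℕ} {a : ℤ → W} {f : ℍ → W}
    (hf : HasQSeries N a f) : ∃ f' : ℍ → W, HasTauDeriv f f' ∧
      HasQSeries N (fun m => (2 * Real.pi * Complex.I * m / N : ℂ) • a m) f' := by
  have : CompleteSpace W := FiniteDimensional.complete ℂ W
  set F : ℤ → ℂ → W := fun m s => e (m / N * s) • a m with hF
  have hFe : ∀ (m : ℤ) (s : ℂ), e (m * s / N) • a m = F m s := by
    intro m s; rw [hF]; congr 2; ring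
  have hFd : ∀ (m : ℤ) (s : ℂ),
      HasDerivAt (F m) (e (m * s / N) • (2 * Real.pi * Complex.I * m / N : ℂ) • a m) s := by
    intro m s
    refine ((hasDerivAt_e (m / N) s).smul_const (a m)).congr_deriv ?_
    rw [smul_smul, show (m : ℂ) * s / N = m / N * s by ring]
    congr 1; ring
  have hFdiff : ∀ m, Differentiable ℂ (F m) := fun m s => (hFd m s).differentiableAt
  have hsum : ∀ s : ℂ, 0 < s.im → f (UpperHalfPlane.ofComplex s) = ∑' m, F m s := by
    intro s hs
    rw [UpperHalfPlane.ofComplex_apply_of_im_pos hs]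
    have h1 := hf ⟨s, hs⟩
    rw [← h1.tsum_eq]
    exact tsum_congr fun m => hFe m s
  have main : ∀ τ : ℍ,
      DifferentiableAt ℂ (fun s : ℂ => f (UpperHalfPlane.ofComplex s)) τ ∧
      HasSum (fun m : ℤ => e (m * τ / N) • (2 * Real.pi * Complex.I * m / N : ℂ) • a m)
        (deriv (fun s : ℂ => f (UpperHalfPlane.ofComplex s)) τ) := by
    intro τ
    have hτ := τ.im_pos
    set U : Set ℂ := {s | τ.im / 2 < s.im} ∩ {s | s.im < 2 * τ.im} with hU
    have hUo : IsOpen U := (isOpen_lt continuous_const Complex.continuous_im).inter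
      (isOpen_lt Complex.continuous_im continuous_const)
    have hτU : (τ : ℂ) ∈ U := ⟨show τ.im / 2 < τ.im by linarith, show τ.im < 2 * τ.im by linarith⟩
    have hpt : ∀ y : ℝ, 0 < y → Summable fun m => ‖F m (Complex.I * y)‖ := by
      intro y hy
      have h1 := hf ⟨Complex.I * y, by simpa using hy⟩
      refine summable_norm_of_finiteDimensional (h1.summable.congr fun m => ?_)
      exact (hFe m _)
    -- In the strip `U` each term is bounded by the sum of its norms on the two edges, since its
    -- norm is monotone in the imaginary part; both edge series converge.
    have hu := (hpt (τ.im / 2) (by linarith)).add (hpt (2 * τ.im) (by linarith))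
    have hle : ∀ (m : ℤ) (s : ℂ), s ∈ U →
        ‖F m s‖ ≤ ‖F m (Complex.I * (τ.im / 2 : ℝ))‖ + ‖F m (Complex.I * (2 * τ.im : ℝ))‖ := by
      intro m s hs
      have hn : ∀ s : ℂ, ‖F m s‖ = Real.exp ((-(2 * Real.pi) * (m / N)) * s.im) * ‖a m‖ := by
        intro s
        rw [hF, norm_smul, norm_e]
        congr 2
        have : (m : ℂ) / N = ((m / N : ℝ) : ℂ) := by push_cast; rfl
        rw [this, Complex.im_ofReal_mul]
        ring
      rw [hn, hn, hn, ← add_mul]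
      refine mul_le_mul_of_nonneg_right ?_ (norm_nonneg _)
      have := exp_mul_le_add_of_mem_Icc hs.1.le hs.2.le (-(2 * Real.pi) * (m / N))
      simpa using this
    have hev : (fun s : ℂ => f (UpperHalfPlane.ofComplex s)) =ᶠ[nhds (τ : ℂ)]
        fun s => ∑' m, F m s := by
      filter_upwards [im_pos_mem_nhds τ] with s hs using hsum s hs
    have hdiff : ∀ m, DifferentiableOn ℂ (F m) U := fun m => (hFdiff m).differentiableOn
    constructor
    · have := Complex.differentiableOn_tsum_of_summable_norm hu hdiff hUo hle
      exact (this.differentiableAt (hUo.mem_nhds hτU)).congr_of_eventuallyEq hev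
    · have := Complex.hasSum_deriv_of_summable_norm hu hdiff hUo hle hτU
      rw [hev.deriv_eq]
      convert this using 2 with m
      exact (hFd m τ).deriv.symm
  exact ⟨fun τ => deriv (fun s : ℂ => f (UpperHalfPlane.ofComplex s)) τ,
    fun τ => (main τ).1.hasDerivAt, fun τ => (main τ).2⟩

theorem HasQSeries.isHolTau [FiniteDimensional ℂ W] {N : ℕ} {a : ℤ → W} {f : ℍ → W}
    (hf : HasQSeries N a f) : IsHolTau f :=
  let ⟨_, h, _⟩ := hf.hasTauDeriv
  h.isHolTau

theorem HasQSeries.derivTau [FiniteDimensional ℂ W] {N : ℕ} {a : ℤ → W} {f : ℍ → W}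
    (hf : HasQSeries N a f) (l : ℕ) :
    HasQSeries N (fun m => (2 * Real.pi * Complex.I * m / N : ℂ) ^ l • a m) (derivTau l f) := by
  have : CompleteSpace W := FiniteDimensional.complete ℂ W
  induction l with
  | zero => simpa [derivTau_zero] using hf
  | succ l ih =>
    obtain ⟨f', h1, h2⟩ := ih.hasTauDeriv
    have h3 : f' = LatticeJacobi.derivTau (l + 1) f := by
      funext τ
      exact (h1 τ).unique (hf.isHolTau.hasTauDeriv l τ)
    rw [← h3]
    simpa only [smul_smul, pow_succ'] using h2

/-- The coefficients of the expansion of `taylorCombination`. -/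
def combCoeff {n : ℕ} (Gram : Fin n → Fin n → ℝ) (x : ℂ) (l N : ℕ) (p : Fin n → ℕ)
    (a : (Fin n → ℕ) → ℤ → W) (m : ℤ) : W :=
  ((4 : ℂ) ^ l * l.factorial) • ∑ Λ ∈ matIndex l p,
    ((∏ i, ∏ j, (-Real.pi * Complex.I * Gram i j) ^ Λ i j / ((Λ i j).factorial : ℂ)) *
      gammaQuot x (l - matSum Λ)) •
        (2 * Real.pi * Complex.I * m / N : ℂ) ^ matSum Λ • a (fun i => p i - matPi Λ i) m

theorem hasQSeries_taylorCombination [FiniteDimensional ℂ W] {n : ℕ} (Gram : Fin n → Fin n → ℝ)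
    (x : ℂ) (l N : ℕ) (p : Fin n → ℕ) {a : (Fin n → ℕ) → ℤ → W} {h : (Fin n → ℕ) → ℍ → W}
    (ha : ∀ p, HasQSeries N (a p) (h p)) :
    HasQSeries N (combCoeff Gram x l N p a) (taylorCombination Gram x l p h) := by
  intro τ
  simp only [combCoeff, taylorCombination]
  have := (hasSum_sum (s := matIndex l p) fun Λ _ =>
    ((ha fun i => p i - matPi Λ i).derivTau (matSum Λ) τ).const_smul
    ((∏ i, ∏ j, (-Real.pi * Complex.I * Gram i j) ^ Λ i j / ((Λ i j).factorial : ℂ)) *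
      gammaQuot x (l - matSum Λ))).const_smul ((4 : ℂ) ^ l * l.factorial)
  convert this using 2 with m
  rw [smul_comm, Finset.smul_sum]
  congr 1
  exact Finset.sum_congr rfl fun Λ _ => smul_comm _ _ _

/-- At `m = 0` the factor `(2 π i m / N) ^ s(Λ)` is zero unless `s(Λ) = 0`: a derivative has no
constant term. -/
theorem exists_of_combCoeff_ne_zero {n : ℕ} {Gram : Fin n → Fin n → ℝ} {x : ℂ} {l N : ℕ}
    {p : Fin n → ℕ} {a : (Fin n → ℕ) → ℤ → W} {m : ℤ} (h : combCoeff Gram x l N p a m ≠ 0) :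
    ∃ Λ : Fin n → Fin n → ℕ, (m = 0 → matSum Λ = 0) ∧ a (fun i => p i - matPi Λ i) m ≠ 0 := by
  obtain ⟨Λ, -, hΛ⟩ := Finset.exists_ne_zero_of_sum_ne_zero (right_ne_zero_of_smul h)
  have h1 := right_ne_zero_of_smul hΛ
  refine ⟨Λ, fun hm => ?_, right_ne_zero_of_smul h1⟩
  by_contra hs
  exact left_ne_zero_of_smul h1 (by simp [hm, hs])

/-! ### Taylor coefficients of a Fourier expansion -/

theorem hasSum_pi_prod {𝕜 : Type*} [RCLike 𝕜] {n : ℕ} (f : Fin n → ℕ → 𝕜) (s : Fin n → 𝕜)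
    (h : ∀ i, HasSum (f i) (s i)) : HasSum (fun j : Fin n → ℕ => ∏ i, f i (j i)) (∏ i, s i) := by
  induction n with
  | zero =>
    simp only [Finset.univ_eq_empty, Finset.prod_empty]
    exact hasSum_unique (fun _ : Fin 0 → ℕ => (1 : 𝕜))
  | succ n ih =>
    have ih' := ih (fun i => f i.succ) (fun i => s i.succ) fun i => h i.succ
    have n1 : Summable fun k => ‖f 0 k‖ := (h 0).summable.norm
    have n2 : Summable fun j : Fin n → ℕ => ‖∏ i : Fin n, f i.succ (j i)‖ := ih'.summable.norm
    have n3 : Summable fun x : ℕ × (Fin n → ℕ) => f 0 x.1 * ∏ i : Fin n, f i.succ (x.2 i) :=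
      summable_mul_of_summable_norm (f := f 0)
        (g := fun j : Fin n → ℕ => ∏ i : Fin n, f i.succ (j i)) n1 n2
    have hm := (h 0).mul ih' n3
    rw [Fin.prod_univ_succ, ← (Fin.consEquiv fun _ : Fin (n + 1) => ℕ).hasSum_iff]
    have e1 : (fun j : Fin (n + 1) → ℕ => ∏ i, f i (j i)) ∘
        (Fin.consEquiv fun _ : Fin (n + 1) => ℕ) =
        fun x : ℕ × (Fin n → ℕ) => f 0 x.1 * ∏ i : Fin n, f i.succ (x.2 i) := by
      funext x
      simp [Fin.consEquiv, Fin.prod_univ_succ]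
    rw [e1]
    exact hm

theorem hasSum_pi_exp {n : ℕ} (x : Fin n → ℂ) :
    HasSum (fun j : Fin n → ℕ => ∏ i, x i ^ j i / ((j i).factorial : ℂ))
      (∏ i, Complex.exp (x i)) :=
  hasSum_pi_prod (fun i k => x i ^ k / (k.factorial : ℂ)) (fun i => Complex.exp (x i)) fun i => by
    rw [Complex.exp_eq_exp_ℂ]; exact NormedSpace.expSeries_div_hasSum_exp _

theorem hasSum_pi_exp_real {n : ℕ} (x : Fin n → ℝ) :
    HasSum (fun j : Fin n → ℕ => ∏ i, x i ^ j i / ((j i).factorial : ℝ))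
      (∏ i, Real.exp (x i)) :=
  hasSum_pi_prod (fun i k => x i ^ k / (k.factorial : ℝ)) (fun i => Real.exp (x i)) fun i => by
    rw [Real.exp_eq_exp_ℝ]; exact NormedSpace.expSeries_div_hasSum_exp _

theorem formC_one_tmul (L : IntegralLattice V) {n : ℕ} (b : Module.Basis (Fin n) ℝ V) (t : V)
    (z : Fin n → ℂ) :
    L.formC ((1 : ℂ) ⊗ₜ[ℝ] t) (∑ i, z i ⊗ₜ[ℝ] b i) = ∑ i, z i * (L.form t (b i) : ℂ) := by
  simp only [IntegralLattice.formC, map_sum, LinearMap.BilinForm.baseChange_tmul]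
  refine Finset.sum_congr rfl fun i _ => ?_
  simp [mul_comm]

/-- The `j`-th Taylor coefficient of `e(B(t, z))`. -/
def expTaylor (L : IntegralLattice V) {n : ℕ} (b : Module.Basis (Fin n) ℝ V) (j : Fin n → ℕ)
    (t : V) : ℂ :=
  ∏ i, (2 * Real.pi * Complex.I * (L.form t (b i) : ℂ)) ^ j i / ((j i).factorial : ℂ)

theorem hasSum_expTaylor (L : IntegralLattice V) {n : ℕ} (b : Module.Basis (Fin n) ℝ V) (t : V)
    (z : Fin n → ℂ) :
    HasSum (fun j : Fin n → ℕ => (∏ i, z i ^ j i) * expTaylor L b j t)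
      (e (L.formC ((1 : ℂ) ⊗ₜ[ℝ] t) (∑ i, z i ⊗ₜ[ℝ] b i))) := by
  have h := hasSum_pi_exp fun i => z i * (2 * Real.pi * Complex.I * (L.form t (b i) : ℂ))
  rw [← Complex.exp_sum] at h
  convert h using 1
  · funext j
    rw [expTaylor, ← Finset.prod_mul_distrib]
    refine Finset.prod_congr rfl fun i _ => ?_
    rw [← mul_div_assoc, ← mul_pow]
  · rw [e, formC_one_tmul, Finset.mul_sum]
    congr 1
    refine Finset.sum_congr rfl fun i _ => by ring

/-- The Taylor series of `e(B(t, z))` in absolute values is dominated by the values of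
`|e(B(t, ·))|` at the points `∑ ± i |z_i| b_i`. -/
theorem hasSum_norm_expTaylor (L : IntegralLattice V) {n : ℕ} (b : Module.Basis (Fin n) ℝ V) (t : V)
    (z : Fin n → ℂ) : ∃ s : ℝ,
    HasSum (fun j : Fin n → ℕ => ‖(∏ i, z i ^ j i) * expTaylor L b j t‖) s ∧
      s ≤ ∑ S : Finset (Fin n), ‖e (L.formC ((1 : ℂ) ⊗ₜ[ℝ] t)
        (∑ i, ((if i ∈ S then (‖z i‖ : ℂ) else -‖z i‖) * Complex.I) ⊗ₜ[ℝ] b i))‖ := by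
  -- This is the exponential series with every term replaced by its absolute value.
  refine ⟨∏ i, Real.exp (‖z i‖ * (2 * Real.pi * |L.form t (b i)|)), ?_, ?_⟩
  · have h := hasSum_pi_exp_real fun i => ‖z i‖ * (2 * Real.pi * |L.form t (b i)|)
    convert h using 1
    funext j
    rw [expTaylor, ← Finset.prod_mul_distrib, norm_prod]
    refine Finset.prod_congr rfl fun i _ => ?_
    simp [mul_pow, abs_of_pos Real.pi_pos, mul_div_assoc]
  · have hS : ∀ S : Finset (Fin n), ‖e (L.formC ((1 : ℂ) ⊗ₜ[ℝ] t)
        (∑ i, ((if i ∈ S then (‖z i‖ : ℂ) else -‖z i‖) * Complex.I) ⊗ₜ[ℝ] b i))‖ =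
        (∏ i ∈ S, Real.exp (-(2 * Real.pi * (‖z i‖ * L.form t (b i))))) *
          ∏ i ∈ Finset.univ \ S, Real.exp (2 * Real.pi * (‖z i‖ * L.form t (b i))) := by
      intro S
      have h1 : ∏ i ∈ Finset.univ \ S, Real.exp (2 * Real.pi * (‖z i‖ * L.form t (b i))) =
          ∏ i ∈ Finset.univ \ S, Real.exp (-(2 * Real.pi *
            ((if i ∈ S then ‖z i‖ else -‖z i‖) * L.form t (b i)))) := by
        refine Finset.prod_congr rfl fun i hi => ?_
        rw [if_neg (Finset.mem_sdiff.1 hi).2]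
        congr 1; ring
      have h2 : ∏ i ∈ S, Real.exp (-(2 * Real.pi * (‖z i‖ * L.form t (b i)))) =
          ∏ i ∈ S, Real.exp (-(2 * Real.pi *
            ((if i ∈ S then ‖z i‖ else -‖z i‖) * L.form t (b i)))) := by
        refine Finset.prod_congr rfl fun i hi => ?_
        rw [if_pos hi]
      rw [h1, h2, mul_comm, Finset.prod_sdiff (Finset.subset_univ S), ← Real.exp_sum, norm_e,
        formC_one_tmul]
      congr 1
      rw [Complex.im_sum, Finset.mul_sum, ← Finset.sum_neg_distrib]
      refine Finset.sum_congr rfl fun i _ => ?_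
      split_ifs <;> simp
    simp only [hS]
    -- The sum over sign patterns is the expanded product of the `exp x + exp (-x)`, and each factor
    -- dominates `exp |x|`.
    rw [← Finset.powerset_univ, ← Finset.prod_add]
    refine Finset.prod_le_prod (fun i _ => (Real.exp_pos _).le) fun i _ => ?_
    have h0 := norm_nonneg (z i)
    rcases abs_cases (L.form t (b i)) with ⟨h, -⟩ | ⟨h, -⟩ <;> rw [h]
    · rw [show ‖z i‖ * (2 * Real.pi * L.form t (b i)) =
        2 * Real.pi * (‖z i‖ * L.form t (b i)) by ring]
      linarith [Real.exp_pos (-(2 * Real.pi * (‖z i‖ * L.form t (b i))))]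
    · rw [show ‖z i‖ * (2 * Real.pi * -L.form t (b i)) =
        -(2 * Real.pi * (‖z i‖ * L.form t (b i))) by ring]
      linarith [Real.exp_pos (2 * Real.pi * (‖z i‖ * L.form t (b i)))]

theorem summable_prod_smul {α β : Type*} [CompleteSpace W] {A : β → α → ℂ} {w : α → W} {s : α → ℝ}
    (hs : ∀ x, HasSum (fun j => ‖A j x‖) (s x)) (h : Summable fun x => s x * ‖w x‖) :
    Summable fun y : α × β => A y.2 y.1 • w y.1 := by
  refine Summable.of_norm ?_
  simp only [norm_smul]
  rw [summable_prod_of_nonneg fun y => mul_nonneg (norm_nonneg _) (norm_nonneg _)]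
  refine ⟨fun x => (hs x).summable.mul_right ‖w x‖, h.congr fun x => ?_⟩
  exact ((hs x).mul_right ‖w x‖).tsum_eq.symm

/-- Expand each `e(B(t, z))` in powers of `z` and exchange the order of summation. The double series
converges absolutely because it is dominated by finitely many Fourier series of `f` at purely
imaginary points. -/
theorem IsJacobiFourier.hasSum_taylor [FiniteDimensional ℂ W] {L : IntegralLattice V} {N : ℕ}
    {f : ℍ → ℂ ⊗[ℝ] V → W} {c : ℝ → V → W} (hc : IsJacobiFourier L N f c) {n : ℕ}
    (b : Module.Basis (Fin n) ℝ V) : ∃ h : (Fin n → ℕ) → ℍ → W, IsTaylorExpansion b f h ∧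
      ∀ (j : Fin n → ℕ) (τ : ℍ),
        HasSum (fun x : ℝ × V => (e (x.1 * τ) * expTaylor L b j x.2) • c x.1 x.2) (h j τ) := by
  have : CompleteSpace W := FiniteDimensional.complete ℂ W
  have joint : ∀ (τ : ℍ) (z : Fin n → ℂ), Summable fun y : (ℝ × V) × (Fin n → ℕ) =>
      ((∏ i, z i ^ y.2 i) * expTaylor L b y.2 y.1.2) • e (y.1.1 * τ) • c y.1.1 y.1.2 := by
    intro τ z
    choose s hs hle using fun t => hasSum_norm_expTaylor L b t z
    refine summable_prod_smul (A := fun (j : Fin n → ℕ) (x : ℝ × V) =>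
      (∏ i, z i ^ j i) * expTaylor L b j x.2) (w := fun x : ℝ × V => e (x.1 * τ) • c x.1 x.2)
      (s := fun x : ℝ × V => s x.2) (fun x => hs x.2) ?_
    have hdom := summable_sum (s := (Finset.univ : Finset (Finset (Fin n)))) fun S _ =>
      summable_norm_of_finiteDimensional (hc.2 τ
        (∑ i, ((if i ∈ S then (‖z i‖ : ℂ) else -‖z i‖) * Complex.I) ⊗ₜ[ℝ] b i)).summable
    refine Summable.of_nonneg_of_le (fun x => ?_) (fun x => ?_) hdom
    · exact mul_nonneg ((hs x.2).nonneg fun j => norm_nonneg _) (norm_nonneg _)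
    · refine (mul_le_mul_of_nonneg_right (hle x.2) (norm_nonneg _)).trans_eq ?_
      rw [Finset.sum_mul]
      refine Finset.sum_congr rfl fun S _ => ?_
      rw [← norm_smul, smul_smul, mul_comm]
  have hsum : ∀ (j : Fin n → ℕ) (τ : ℍ),
      Summable fun x : ℝ × V => (e (x.1 * τ) * expTaylor L b j x.2) • c x.1 x.2 := by
    intro j τ
    -- At `z = (1, …, 1)` every monomial equals `1`, so the slice at `j` is exactly the required
    -- series.
    have := ((joint τ fun _ => 1).prod_symm).prod_factor j
    refine this.congr fun x => ?_
    simp [smul_smul, mul_comm]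
  refine ⟨fun j τ => ∑' x : ℝ × V, (e (x.1 * τ) * expTaylor L b j x.2) • c x.1 x.2,
    fun τ z => ?_, fun j τ => (hsum j τ).hasSum⟩
  have h1 := (joint τ z).hasSum
  have h2 := h1.prod_fiberwise fun x => ((hasSum_expTaylor L b x.2 z).smul_const
    (e (x.1 * τ) • c x.1 x.2))
  have h3 := hc.2 τ (∑ i, z i ⊗ₜ[ℝ] b i)
  have h4 : (fun x : ℝ × V => (e (x.1 * τ) *
      e (L.formC ((1 : ℂ) ⊗ₜ[ℝ] x.2) (∑ i, z i ⊗ₜ[ℝ] b i))) • c x.1 x.2) = fun x : ℝ × V =>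
      e (L.formC ((1 : ℂ) ⊗ₜ[ℝ] x.2) (∑ i, z i ⊗ₜ[ℝ] b i)) • e (x.1 * τ) • c x.1 x.2 := by
    funext x; rw [smul_smul, mul_comm]
  rw [h4] at h3
  rw [h2.unique h3] at h1
  have h5 := ((Equiv.prodComm (Fin n → ℕ) (ℝ × V)).hasSum_iff).2 h1
  refine h5.prod_fiberwise fun j => ?_
  have h6 := ((hsum j τ).hasSum).const_smul (∏ i, z i ^ j i)
  convert h6 using 2 with x
  simp only [Function.comp, Equiv.prodComm_apply, Prod.swap_prod_mk, smul_smul]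
  congr 1
  ring

/-- The coefficient of `q^(m / N)` in the `j`-th Taylor coefficient. -/
def taylorQCoeff (L : IntegralLattice V) {n : ℕ} (b : Module.Basis (Fin n) ℝ V) (N : ℕ)
    (c : ℝ → V → W) (j : Fin n → ℕ) (m : ℤ) : W :=
  ∑' t : V, expTaylor L b j t • c (m / N) t

theorem IsJacobiFourier.hasQSeries_taylor [FiniteDimensional ℂ W] {L : IntegralLattice V} {N : ℕ}
    (hN : 0 < N) {f : ℍ → ℂ ⊗[ℝ] V → W} {c : ℝ → V → W} (hc : IsJacobiFourier L N f c) {n : ℕ}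
    (b : Module.Basis (Fin n) ℝ V) : ∃ h : (Fin n → ℕ) → ℍ → W, IsTaylorExpansion b f h ∧
      ∀ j, HasQSeries N (taylorQCoeff L b N c j) (h j) := by
  have : CompleteSpace W := FiniteDimensional.complete ℂ W
  obtain ⟨h, h1, h2⟩ := hc.hasSum_taylor b
  refine ⟨h, h1, fun j τ => ?_⟩
  have hN' : (N : ℝ) ≠ 0 := by exact_mod_cast hN.ne'
  -- The real exponents are reindexed by integers through `n = m / N`; coefficients off this image
  -- vanish by `hc.1`.
  have hinj : Function.Injective fun y : ℤ × V => ((y.1 / N : ℝ), y.2) := by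
    rintro ⟨m, t⟩ ⟨m', t'⟩ hy
    obtain ⟨ha, hb⟩ := Prod.ext_iff.1 hy
    simp only at ha hb
    rw [div_left_inj' hN'] at ha
    exact Prod.ext (by exact_mod_cast ha) hb
  have h3 := (hinj.hasSum_iff (fun x hx => ?_)).2 (h2 j τ)
  · have h4 := h3.prod_fiberwise (fun m => (h3.summable.prod_factor m).hasSum)
    convert h4 using 2 with m
    rw [taylorQCoeff, ← tsum_const_smul'']
    refine tsum_congr fun t => ?_
    simp only [Function.comp, smul_smul]
    congr 3
    push_cast; ring
  · by_contra hne
    obtain ⟨⟨m, hm⟩, -⟩ := hc.1 _ _ (right_ne_zero_of_smul hne)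
    exact hx ⟨(m, x.2), Prod.ext hm.symm rfl⟩

theorem exists_of_taylorQCoeff_ne_zero {L : IntegralLattice V} {n : ℕ}
    {b : Module.Basis (Fin n) ℝ V} {N : ℕ} {c : ℝ → V → W} {j : Fin n → ℕ} {m : ℤ}
    (h : taylorQCoeff L b N c j m ≠ 0) : ∃ t, c (m / N) t ≠ 0 ∧ expTaylor L b j t ≠ 0 := by
  by_contra! hne
  refine h ?_
  rw [taylorQCoeff, ← tsum_zero]
  refine tsum_congr fun t => ?_
  by_cases ht : c (m / N) t = 0
  · rw [ht, smul_zero]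
  · rw [hne t ht, zero_smul]

/-- At `t = 0` the exponential is the constant `1`, which has only its coefficient of index `0`. -/
theorem expTaylor_zero {L : IntegralLattice V} {n : ℕ} {b : Module.Basis (Fin n) ℝ V}
    {j : Fin n → ℕ} (h : expTaylor L b j 0 ≠ 0) : j = 0 := by
  funext i
  have := Finset.prod_ne_zero_iff.1 h i (Finset.mem_univ i)
  by_contra hi
  exact this (by simp [show j i ≠ 0 from hi])

variable [FiniteDimensional ℂ W]

/-! ### Modularity of the modified Taylor coefficients -/

theorem jacobiSlash_one (k₂ : ℤ) (L : IntegralLattice V) (φ : ℍ → ℂ ⊗[ℝ] V → W) :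
    jacobiSlash k₂ φ (1 : JacobiGroup L) = φ := by
  funext τ z
  simp [jacobiSlash, jacobiFactor, shift, e, IntegralLattice.Q, den]

/-- If `φ|γ` has a Fourier expansion for every `γ`, its Taylor coefficients are holomorphic. -/
theorem isHolTau_of_isTaylorExpansion {k₂ : ℤ} {L : IntegralLattice V} {G : Subgroup SL(2, ℤ)}
    {ρ : jacobiSubgroup L G →* (W ≃ₗ[ℂ] W)} {φ : ℍ → ℂ ⊗[ℝ] V → W}
    (hφ : IsWeaklyHolomorphicJacobiForm k₂ L G ρ φ) {n : ℕ} {b : Module.Basis (Fin n) ℝ V}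
    {h : (Fin n → ℕ) → ℍ → W} (hh : IsTaylorExpansion b φ h) (p : Fin n → ℕ) :
    IsHolTau (h p) := by
  have : CompleteSpace W := FiniteDimensional.complete ℂ W
  -- Holomorphy comes from the expansion at the identity: the coefficients are convergent series in
  -- `q ^ (1 / N)`, and `unique` identifies them with `h`.
  obtain ⟨N₀, N, c, hN, hc, -⟩ := hφ.2 1 (one_mem _)
  rw [jacobiSlash_one] at hc
  obtain ⟨h', h1, h2⟩ := hc.hasQSeries_taylor hN b
  rw [hh.unique h1]
  exact (h2 p).isHolTau

/-- The expansion at a cusp of the modified Taylor coefficient, from the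
Fourier expansion of `φ`. -/
theorem hasQSeries_modifiedTaylor_slash {k₂ : ℤ} {L : IntegralLattice V}
    {φ : ℍ → ℂ ⊗[ℝ] V → W} {n : ℕ} {b : Module.Basis (Fin n) ℝ V}
    {h : (Fin n → ℕ) → ℍ → W} (hh : IsTaylorExpansion b φ h) (hol : ∀ p, IsHolTau (h p))
    (p : Fin n → ℕ) {γ : Mp} {N : ℕ} (hN : 0 < N) {c : ℝ → V → W}
    (hc : IsJacobiFourier L N (jacobiSlash k₂ φ (ofMp L γ)) c) :
    ∃ a : ℤ → W, HasQSeries N a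
        (modularSlash (k₂ + 2 * ∑ i, (p i : ℤ)) (modifiedTaylor k₂ L b p h) γ) ∧
      ∀ m, a m ≠ 0 → ∃ (j : Fin n → ℕ) (t : V), c (m / N) t ≠ 0 ∧ expTaylor L b j t ≠ 0 ∧
        (m = 0 → j = p) := by
  have : CompleteSpace W := FiniteDimensional.complete ℂ W
  obtain ⟨h', h1, h2⟩ := hc.hasQSeries_taylor hN b
  rw [← modifiedTaylor_slash hh h1 hol (fun q => (h2 q).isHolTau) p, modifiedTaylor_eq k₂ L b rfl]
  refine ⟨_, hasQSeries_taylorCombination _ _ _ N p h2, fun m hm => ?_⟩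
  obtain ⟨Λ, hΛ, ha⟩ := exists_of_combCoeff_ne_zero hm
  obtain ⟨t, ht, hj⟩ := exists_of_taylorQCoeff_ne_zero ha
  refine ⟨_, t, ht, hj, fun hm0 => funext fun i => ?_⟩
  -- At `m = 0` the matrix has entry sum zero, hence `π(Λ) = 0` and the index `p - π(Λ)` is `p`
  -- itself.
  have h0 := sum_matPi Λ
  rw [hΛ hm0, mul_zero, Finset.sum_eq_zero_iff] at h0
  rw [h0 i (Finset.mem_univ i), Nat.sub_zero]

theorem isHolTau_taylorCombination {n : ℕ} (Gram : Fin n → Fin n → ℝ) (x : ℂ) (l : ℕ)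
    (p : Fin n → ℕ) {h : (Fin n → ℕ) → ℍ → W} (hol : ∀ p, IsHolTau (h p)) :
    IsHolTau (taylorCombination Gram x l p h) := by
  have : CompleteSpace W := FiniteDimensional.complete ℂ W
  exact (IsHolTau.sum_const_smul _ _ fun Λ _ => (hol _).derivTau _).const_smul _

theorem taylorCombination_clm_comp {n : ℕ} (Gram : Fin n → Fin n → ℝ) (x : ℂ) (l : ℕ)
    (p : Fin n → ℕ) {h : (Fin n → ℕ) → ℍ → W} (hol : ∀ p, IsHolTau (h p)) (T : W →L[ℂ] W) :
    taylorCombination Gram x l p (fun j τ => T (h j τ)) =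
      fun τ => T (taylorCombination Gram x l p h τ) := by
  have : CompleteSpace W := FiniteDimensional.complete ℂ W
  funext τ
  simp only [taylorCombination, map_smul, map_sum]
  congr 1
  refine Finset.sum_congr rfl fun Λ _ => ?_
  rw [derivTau_clm_comp T (hol _)]

theorem isModularHol_modifiedTaylor {k₂ : ℤ} {L : IntegralLattice V} {G : Subgroup SL(2, ℤ)}
    {ρ : jacobiSubgroup L G →* (W ≃ₗ[ℂ] W)} {φ : ℍ → ℂ ⊗[ℝ] V → W}
    (hφ : IsWeaklyHolomorphicJacobiForm k₂ L G ρ φ) {n : ℕ} {b : Module.Basis (Fin n) ℝ V}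
    {h : (Fin n → ℕ) → ℍ → W} (hh : IsTaylorExpansion b φ h) (p : Fin n → ℕ) :
    IsModularHol (k₂ + 2 * ∑ i, (p i : ℤ)) G (ρ.comp (coverToJacobi L G))
      (modifiedTaylor k₂ L b p h) := by
  have : CompleteSpace W := FiniteDimensional.complete ℂ W
  have hol := isHolTau_of_isTaylorExpansion hφ hh
  refine ⟨?_, fun γ τ => ?_⟩
  · rw [modifiedTaylor_eq k₂ L b rfl]
    exact isHolTau_taylorCombination _ _ _ _ hol
  · set T : W →L[ℂ] W := LinearMap.toContinuousLinearMap
      (ρ (coverToJacobi L G γ) : W ≃ₗ[ℂ] W).toLinearMap with hT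
    have hT' : ∀ w, T w = ρ (coverToJacobi L G γ) w := fun w => rfl
    have htrans : jacobiSlash k₂ φ (ofMp L (γ : Mp)) = fun τ z => T (φ τ z) := by
      funext τ z
      exact hφ.1.2 (coverToJacobi L G γ) τ z
    have hh' : IsTaylorExpansion b (jacobiSlash k₂ φ (ofMp L (γ : Mp))) fun j τ => T (h j τ) := by
      intro τ z
      rw [htrans]
      have := T.hasSum (hh τ z)
      simpa only [Function.comp_def, map_smul] using this
    have hol' : ∀ j, IsHolTau fun τ => T (h j τ) := fun j => by
      have := ((hol j).hasTauDeriv 0).clm_comp T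
      rw [derivTau_zero] at this
      exact this.isHolTau
    rw [← modifiedTaylor_slash hh hh' hol hol' p, modifiedTaylor_eq k₂ L b rfl,
      modifiedTaylor_eq k₂ L b rfl, taylorCombination_clm_comp _ _ _ _ hol]
    rfl

/-! ### Positivity of the quadratic form. -/

theorem IntegralLattice.eq_zero_of_Q_nonpos (L : IntegralLattice V) {t : V} (h : L.Q t ≤ 0) :
    t = 0 := by
  by_contra ht
  have := L.pos t ht
  rw [IntegralLattice.Q] at h
  linarith

theorem IntegralLattice.Q_nonneg (L : IntegralLattice V) (t : V) : 0 ≤ L.Q t := by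
  by_contra! h
  have := L.eq_zero_of_Q_nonpos h.le
  simp [this, IntegralLattice.Q] at h

end LatticeJacobi

end

/-! ### The behaviour at the cusps for the three kinds of Jacobi forms. -/

open LatticeJacobi
theorem mainTheorem4
    {V : Type*} [AddCommGroup V] [Module ℝ V]
    {W : Type*} [NormedAddCommGroup W] [NormedSpace ℂ W] [FiniteDimensional ℂ W]
    (k₂ : ℤ) (L : IntegralLattice V)
    (G : Subgroup SL(2, ℤ)) (hG : G.FiniteIndex)
    (ρ : jacobiSubgroup L G →* (W ≃ₗ[ℂ] W)) (hρ : ρ.ker.FiniteIndex)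
    {n : ℕ} (b : Module.Basis (Fin n) ℝ V)
    (φ : ℍ → ℂ ⊗[ℝ] V → W) (hφ : IsWeaklyHolomorphicJacobiForm k₂ L G ρ φ)
    (h : (Fin n → ℕ) → ℍ → W) (hh : IsTaylorExpansion b φ h)
    (p : Fin n → ℕ) :
    IsWeaklyHolomorphicModularForm (k₂ + 2 * ∑ i, (p i : ℤ)) G (ρ.comp (coverToJacobi L G))
        (modifiedTaylor k₂ L b p h) ∧
      (IsWeakJacobiForm k₂ L G ρ φ →
        IsModularForm (k₂ + 2 * ∑ i, (p i : ℤ)) G (ρ.comp (coverToJacobi L G))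
          (modifiedTaylor k₂ L b p h)) ∧
      (IsJacobiForm k₂ L G ρ φ → p ≠ 0 →
        IsCuspForm (k₂ + 2 * ∑ i, (p i : ℤ)) G (ρ.comp (coverToJacobi L G))
          (modifiedTaylor k₂ L b p h)) := by
  have hmod := isModularHol_modifiedTaylor hφ hh p
  have hol := isHolTau_of_isTaylorExpansion hφ hh
  refine ⟨⟨hmod, fun γ => ?_⟩, fun hw => ⟨hmod, fun γ => ?_⟩, fun hj hp => ⟨hmod, fun γ => ?_⟩⟩
  · obtain ⟨N₀, N, c, hN, hc, hb⟩ := hφ.2 _ (ofMp_mem L γ)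
    obtain ⟨a, ha, hsupp⟩ := hasQSeries_modifiedTaylor_slash hh hol p hN hc
    -- The exponent of `q` is `n = m / N`, so `n ≥ N₀` means `m ≥ N₀ N`.
    refine ⟨⌈(N₀ : ℝ) * N⌉, N, a, hN, fun m hm => ?_, ha⟩
    obtain ⟨j, t, ht, -, -⟩ := hsupp m hm
    have hN' : (0 : ℝ) < N := by exact_mod_cast hN
    exact Int.ceil_le.2 ((le_div_iff₀ hN').1 (hb _ _ ht))
  · obtain ⟨N, c, hN, hc, hb⟩ := hw.2 _ (ofMp_mem L γ)
    obtain ⟨a, ha, hsupp⟩ := hasQSeries_modifiedTaylor_slash hh hol p hN hc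
    refine ⟨N, a, hN, fun m hm => ?_, ha⟩
    obtain ⟨j, t, ht, -, -⟩ := hsupp m hm
    have hN' : (0 : ℝ) < N := by exact_mod_cast hN
    have := (le_div_iff₀ hN').1 (hb _ _ ht)
    rw [zero_mul] at this
    exact_mod_cast this
  · obtain ⟨N, c, hN, hc, hb⟩ := hj.2 _ (ofMp_mem L γ)
    obtain ⟨a, ha, hsupp⟩ := hasQSeries_modifiedTaylor_slash hh hol p hN hc
    refine ⟨N, a, hN, fun m hm => ?_, ha⟩
    obtain ⟨j, t, ht, hjt, hm0⟩ := hsupp m hm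
    have hN' : (0 : ℝ) < N := by exact_mod_cast hN
    have hQ := hb _ _ ht
    have hm1 := (le_div_iff₀ hN').1 (show (0 : ℝ) ≤ m / N by linarith [L.Q_nonneg t])
    rw [zero_mul] at hm1
    -- If `m = 0`, then `0 - Q(t) ≥ 0` forces `t = 0`; the Taylor index involved is `p`, and a
    -- nonzero `expTaylor` at `t = 0` makes `p = 0`.
    refine lt_of_le_of_ne (by exact_mod_cast hm1) fun h0 => ?_
    subst h0
    have ht0 : t = 0 := L.eq_zero_of_Q_nonpos (by simpa using hQ)
    subst ht0
    exact hp ((hm0 rfl).symm.trans (expTaylor_zero hjt))
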